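/- Let $d\ge 2$, let $\Omega\subset\mathbb R^d$ be a bounded connected Lipschitz domain and let $D$ be a (nonempty) connected Lipschitz domain with $\overline D\subset\Omega$. All functions are real-valued. Call $u\in H^1(\Omega)$ a weak solution of $-\Delta u=f$ in $\Omega$, $\partial_\nu u=0$ on $\partial\Omega$ (with $f\in L^2(\Omega)$) if $\int_\Omega\nabla u\cdot\nabla w\,dx=\int_\Omega f w\,dx$ for all $w\in H^1(\Omega)$. **Preliminaries.** $L^2(\Omega)$ has an orthonormal basis $\{\chi_k\}_{k\ge0}$ of weak Neumann eigenfunctions of $-\Delta$, with eigenvalues $\mu_k$ in nondecreasing order. For every such basis, $\chi_0$ is constant, $0=\mu_0<\mu_1\le\mu_2\le\cdots$ and $\mu_k\to\infty$, and $$(-\Delta)^{-1/2}f:=\sum_{k\ge1}\mu_k^{-1/2}\Bigl(\int_\Omega f\chi_k\,dx\Bigr)\chi_k$$ defines a bounded operator on $L^2(\Omega)$ (which vanishes on constants). **Theorem.** (a) The operator $K_0:=(-\Delta)^{-1/2}1_D(-\Delta)^{-1/2}$ is compact, self-adjoint and nonnegative on $L^2(\Omega)$. So is its variant with the additive constant normalized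 by zero mean over $D$, $$K v:=(-\Delta)^{-1/2}\,1_D\bigl((-\Delta)^{-1/2}v+\ell(v)\bigr),\qquad \ell(v):=-\frac1{|D|}\int_D(-\Delta)^{-1/2}v\,dx .$$ (b) There are $0<\lambda_1\le\lambda_2\le\cdots$ with $\lambda_k\to\infty$, and nonzero $\phi_k\in H^1(\Omega)$ that are weak solutions of $$-\Delta\phi_k=\lambda_k1_D\phi_k\ \text{ in }\Omega,\qquad \partial_\nu\phi_k=0\ \text{ on }\partial\Omega,$$ with $\int_D\phi_k\,dx=0$ for all $k$ and $\int_D\phi_k\phi_l\,dx=0$ for $k\ne l$. (c) These pairs are obtained from $K$: there is an orthonormal basis $\{v_k\}$ of $(\ker K)^\perp$ with $Kv_k=\lambda_k^{-1}v_k$ and $\phi_k=(-\Delta)^{-1/2}v_k+\ell(v_k)$ for all $k$. They exhaust the problem with multiplicity: if $\lambda\in\mathbb R\setminus\{0\}$ and $u\in H^1(\Omega)$ is a weak solution of $-\Delta u=\lambda1_Du$ in $\Omega$, $\partial_\nu u=0$ on $\partial\Omega$, then $u$ lies in the span of $\{\phi_k:\lambda_k=\lambda\}$. -/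

import Mathlib

open MeasureTheory Filter Topology
open scoped ContDiff

noncomputable section

namespace DegenerateNeumann

/-- Euclidean space `ℝ^d`. -/
abbrev Eucl (d : ℕ) : Type := EuclideanSpace ℝ (Fin d)

/-- A Lipschitz domain: a nonempty connected open set which, near each point of its boundary, is
the set of points lying on one side of the graph of a Lipschitz function. Here `ν` is the unit
vector in the direction of the graph, `y - ⟪ν, y⟫ ν` is the projection of `y` on the hyperplane
orthogonal to `ν`, and only the values of `γ` on that hyperplane matter. -/
structure IsLipschitzDomain {d : ℕ} (U : Set (Eucl d)) : Prop where
  isOpen : IsOpen U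
  isConnected : IsConnected U
  boundary : ∀ x ∈ frontier U, ∃ (ν : Eucl d) (γ : Eucl d → ℝ) (L : NNReal) (r : ℝ),
    ‖ν‖ = 1 ∧ LipschitzWith L γ ∧ 0 < r ∧
      ∀ y ∈ Metric.ball x r, y ∈ U ↔ γ (y - inner ℝ ν y • ν) < inner ℝ ν y

/-- The real Hilbert space `L²(Ω)`. -/
abbrev L2 {d : ℕ} (Ω : Set (Eucl d)) : Type := Lp ℝ 2 (volume.restrict Ω)

/-- The space `L²(Ω; ℝ^d)` of square-integrable vector fields. -/
abbrev L2Vec {d : ℕ} (Ω : Set (Eucl d)) : Type := Lp (Eucl d) 2 (volume.restrict Ω)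

/-- `g ∈ L²(Ω; ℝ^d)` is the distributional gradient of `u ∈ L²(Ω)` in `Ω`. Thus `u ∈ H¹(Ω)` iff
`∃ g, IsWeakGradient Ω u g`. -/
def IsWeakGradient {d : ℕ} (Ω : Set (Eucl d)) (u : L2 Ω) (g : L2Vec Ω) : Prop :=
  ∀ ψ : Eucl d → ℝ, ContDiff ℝ ∞ ψ → HasCompactSupport ψ → tsupport ψ ⊆ Ω →
    ∀ e : Eucl d,
      ∫ x in Ω, u x * fderiv ℝ ψ x e = - ∫ x in Ω, inner ℝ (g x) e * ψ x

/-- `u ∈ H¹(Ω)` is a weak solution of `-Δu = f` in `Ω`, `∂_ν u = 0` on `∂Ω`: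
`∫_Ω ∇u · ∇w = ∫_Ω f w` for all `w ∈ H¹(Ω)`. -/
def IsWeakNeumannSolution {d : ℕ} (Ω : Set (Eucl d)) (u f : L2 Ω) : Prop :=
  ∃ g : L2Vec Ω, IsWeakGradient Ω u g ∧
    ∀ (w : L2 Ω) (h : L2Vec Ω), IsWeakGradient Ω w h →
      ∫ x in Ω, inner ℝ (g x) (h x) = ∫ x in Ω, f x * w x

/-- The product `1_D u ∈ L²(Ω)`. -/
def cutoff {d : ℕ} {Ω D : Set (Eucl d)} (hD : IsLipschitzDomain D) (u : L2 Ω) : L2 Ω :=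
  ((Lp.memLp u).indicator hD.isOpen.measurableSet).toLp (D.indicator u)

/-- The constant function `c` as an element of `L²(Ω)`, for bounded `Ω`. -/
def constL2 {d : ℕ} {Ω : Set (Eucl d)} (hΩ : Bornology.IsBounded Ω) (c : ℝ) : L2 Ω :=
  (show MemLp (fun _ : Eucl d => c) 2 (volume.restrict Ω) from
    haveI : IsFiniteMeasure (volume.restrict Ω) :=
      isFiniteMeasure_restrict.2 hΩ.measure_lt_top.ne
    memLp_const c).toLp (fun _ => c)

/-- `χ` is an orthonormal basis of `L²(Ω)` made of (weak) eigenfunctions of the Neumann Laplacian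
`-Δ` in `Ω`, and `μ` is the nondecreasing sequence of the associated eigenvalues. -/
structure IsNeumannEigenbasis {d : ℕ} (Ω : Set (Eucl d)) (χ : ℕ → L2 Ω) (μ : ℕ → ℝ) : Prop where
  orthonormal : Orthonormal ℝ χ
  complete : (Submodule.span ℝ (Set.range χ)).topologicalClosure = ⊤
  eigen : ∀ k, IsWeakNeumannSolution Ω (χ k) (μ k • χ k)
  monotone : Monotone μ

/-- `T` is the operator `(-Δ)^{-1/2}`, given on the mean-zero functions by
`T f = ∑_{k ≥ 1} μ_k^{-1/2} ⟪χ_k, f⟫ χ_k` and extended to `L²(Ω)` by `0` on the constants, which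
are the multiples of `χ_0`. -/
def IsInvSqrtNeumann {d : ℕ} {Ω : Set (Eucl d)} (χ : ℕ → L2 Ω) (μ : ℕ → ℝ)
    (T : L2 Ω →L[ℝ] L2 Ω) : Prop :=
  ∀ f : L2 Ω,
    HasSum (fun k : ℕ => ((√(μ (k + 1)))⁻¹ * inner ℝ (χ (k + 1)) f) • χ (k + 1)) (T f)

/-- `(-Δ)^{-1/2} v`, with an additive constant added so that the mean over `D` is zero:
`T v - |D|⁻¹ ∫_D T v`. -/
def shifted {d : ℕ} {Ω : Set (Eucl d)} (D : Set (Eucl d)) (hΩ : Bornology.IsBounded Ω)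
    (T : L2 Ω →L[ℝ] L2 Ω) (v : L2 Ω) : L2 Ω :=
  T v - constL2 hΩ (⨍ x in D, T v x)

end DegenerateNeumann

end

noncomputable section

namespace DegenerateNeumann

/-! ### Hilbert space tools: compact operators, weak limits, diagonal operators. -/

section

section Hilbert

variable {H : Type*} [NormedAddCommGroup H] [InnerProductSpace ℝ H]

/-! Write `T` for the inverse square root, `P` for multiplication by the indicator of `D`, and `Z`
for subtraction of the mean over `D`. Then `K = T P Z T`, and `P Z` is an orthogonal projection of
L²(Ω), so ⟨K x, y⟩ = ⟨PZT x, PZT y⟩. Symmetry and nonnegativity follow at once, and compactness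
comes from `T`, whose eigenvalues μ_k^{-1/2} tend to 0. The unnormalized operator is handled in the
same way with `P` in place of `P Z`.

The spectral theorem (`exists_antitone_eigenbasis`) gives `v k` with positive eigenvalues `s k`; put
λ_k = 1 / s_k and φ_k = Z T v_k. The range of `P Z` is orthogonal to constants, and for such f the
function T T f solves the Neumann problem with right-hand side f. From v_k = λ_k T P φ_k one gets
φ_k = T T (λ_k P φ_k) minus a constant, which is the weighted equation. There are infinitely many
eigenvalues because `T` is injective on the infinite-dimensional range of `P Z` and maps it into the
orthogonal complement of ker K. Conversely, testing the equation of u with 1 shows that u has zero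
mean over `D` when λ ≠ 0. Then w = T(λ P u) satisfies Z T w = u and w = λ K w, so w is a finite
combination of the v_k with λ_k = λ, and applying Z T gives u.

The analytic input is the Rellich theorem (`rellich`). It yields the Neumann eigenbasis, as the
eigenvectors of the compact resolvent J J* with J : H¹ → L² the embedding, and also μ_k → ∞. It is
proved without an extension operator, from `translation_estimate` alone. On compact subsets, a
function is compared with its averages over small balls. Near the boundary, the mass of a thin strip
is compared with that of many disjoint translates pushed into the domain. -/

theorem tendsto_inner_of_orthonormal {w : ℕ → H} (hw : Orthonormal ℝ w) (x : H) :
    Tendsto (fun n => inner ℝ (w n) x) atTop (𝓝 0) := by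
  have h := (hw.inner_products_summable x).tendsto_atTop_zero
  have h2 := h.sqrt
  rw [tendsto_zero_iff_norm_tendsto_zero]
  simpa [Real.sqrt_sq_eq_abs] using h2

theorem mem_orthogonal_span_range {ι : Type*} {w : ι → H} {x : H} :
    x ∈ (Submodule.span ℝ (Set.range w))ᗮ ↔ ∀ i, inner ℝ (w i) x = 0 := by
  rw [Submodule.mem_orthogonal]
  refine ⟨fun h i => h _ (Submodule.subset_span ⟨i, rfl⟩), fun h u hu => ?_⟩
  induction hu using Submodule.span_induction with
  | mem y hy => obtain ⟨i, rfl⟩ := hy; exact h i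
  | zero => simp
  | add a b _ _ ha hb => rw [inner_add_left, ha, hb, add_zero]
  | smul c a _ ha => rw [inner_smul_left, ha, mul_zero]

/-- Orthonormal sequences are weakly null. If a subsequence of `A (w n)` has limit y,
self-adjointness gives ⟨y, y⟩ = lim ⟨w n, A y⟩ = 0. -/
theorem tendsto_zero_of_isCompactOperator [CompleteSpace H] {A : H →L[ℝ] H}
    (hA : IsCompactOperator A) (hs : IsSelfAdjoint A) {w : ℕ → H} (hw : Orthonormal ℝ w) :
    Tendsto (fun n => A (w n)) atTop (𝓝 0) := by
  refine tendsto_of_subseq_tendsto fun ns hns => ?_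
  obtain ⟨C, hC, hsub⟩ :=
    IsCompactOperator.image_closedBall_subset_compact (𝕜₁ := ℝ) (f := A.toLinearMap) hA 1
  obtain ⟨y, -, ms, hms, hy⟩ := hC.tendsto_subseq (x := fun n => A (w (ns n)))
    (fun n => hsub ⟨w (ns n), by simp [hw.1], rfl⟩)
  refine ⟨ms, ?_⟩
  have h0 : y = 0 := by
    rw [← inner_self_eq_zero (𝕜 := ℝ)]
    have h1 : Tendsto (fun n => inner ℝ (A (w (ns (ms n)))) y) atTop (𝓝 (inner ℝ y y)) :=
      hy.inner tendsto_const_nhds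
    have h2 : Tendsto (fun n => inner ℝ (A (w (ns (ms n)))) y) atTop (𝓝 0) := by
      have := (tendsto_inner_of_orthonormal hw (A y)).comp (hns.comp hms.tendsto_atTop)
      refine this.congr fun n => ?_
      exact (hs.isSymmetric (w (ns (ms n))) y).symm
    exact tendsto_nhds_unique h1 h2
  rw [← h0]
  exact hy

/-- Order ι by decreasing `s`, ties being broken by an injection into ℕ. Initial segments are finite
and there is no largest element, so this order is isomorphic to ℕ. -/
theorem exists_equiv_nat_antitone {ι : Type*} [Infinite ι] (s : ι → ℝ) (hpos : ∀ i, 0 < s i)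
    (hfin : ∀ ε > 0, {i | ε ≤ s i}.Finite) : ∃ e : ℕ ≃ ι, Antitone (s ∘ e) := by
  have hc : Countable ι := by
    have : (Set.univ : Set ι) = ⋃ n : ℕ, {i | 1 / ((n : ℝ) + 1) ≤ s i} := by
      ext i
      simp only [Set.mem_univ, Set.mem_iUnion, Set.mem_ofPred_eq, true_iff]
      obtain ⟨n, hn⟩ := exists_nat_one_div_lt (hpos i)
      exact ⟨n, hn.le⟩
    rw [← Set.countable_univ_iff, this]
    exact Set.countable_iUnion fun n => (hfin _ (by positivity)).countable
  obtain ⟨e0, he0⟩ := hc.exists_injective_nat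
  let F : ι → ℝ ×ₗ ℕ := fun i => toLex (-s i, e0 i)
  have hF : Function.Injective F := fun i j h => he0 (by simpa [F] using congrArg (fun p => (ofLex p).2) h)
  let : LinearOrder ι := LinearOrder.lift' F hF
  have hle : ∀ i j : ι, i ≤ j → s j ≤ s i := by
    intro i j h
    have h' : F i ≤ F j := h
    rcases (Prod.Lex.le_iff.1 h') with h1 | h1
    · have : -s i < -s j := h1
      linarith
    · have : -s i = -s j := h1.1
      linarith
  have hIic : ∀ i : ι, (Set.Iic i).Finite := fun i =>
    (hfin (s i) (hpos i)).subset fun j hj => hle j i hj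
  let : LocallyFiniteOrder ι :=
    LocallyFiniteOrder.ofFiniteIcc fun a b => (hIic b).subset fun x hx => hx.2
  have : NoMaxOrder ι := ⟨fun a => by
    obtain ⟨b, hb⟩ := (hIic a).exists_notMem
    exact ⟨b, not_le.1 hb⟩⟩
  obtain ⟨i0⟩ : Nonempty ι := inferInstance
  obtain ⟨m, hm, hmin⟩ := (hIic i0).exists_minimal ⟨i0, le_refl i0⟩
  have hbot : ∀ a, m ≤ a := fun a => by
    by_contra hcon
    have h1 := le_of_lt (not_le.1 hcon)
    exact hcon (hmin (h1.trans hm) h1)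
  let : OrderBot ι := { bot := m, bot_le := hbot }
  let : SuccOrder ι := LinearLocallyFiniteOrder.succOrder ι
  let : PredOrder ι := LinearLocallyFiniteOrder.predOrder ι
  refine ⟨(orderIsoNatOfLinearSuccPredArch (ι := ι)).symm.toEquiv, fun a b hab => hle _ _ ?_⟩
  exact (orderIsoNatOfLinearSuccPredArch (ι := ι)).symm.monotone hab

/-- The spectral theorem for compact nonnegative operators, with the positive eigenvalues listed in
nonincreasing order. -/
theorem exists_antitone_eigenbasis [CompleteSpace H] {A : H →L[ℝ] H} (hA : IsCompactOperator A)
    (hs : IsSelfAdjoint A) (hnn : ∀ x, 0 ≤ inner ℝ (A x) x)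
    (hinf : ¬ FiniteDimensional ℝ ((LinearMap.ker (A : H →ₗ[ℝ] H))ᗮ : Submodule ℝ H)) :
    ∃ (w : ℕ → H) (s : ℕ → ℝ), Orthonormal ℝ w ∧ Antitone s ∧ (∀ n, 0 < s n) ∧
      Tendsto s atTop (𝓝 0) ∧ (∀ n, A (w n) = s n • w n) ∧
      (Submodule.span ℝ (Set.range w)).topologicalClosure =
        (LinearMap.ker (A : H →ₗ[ℝ] H))ᗮ := by
  have hsym : (A : H →ₗ[ℝ] H).IsSymmetric := hs.isSymmetric
  -- The value 0 is excluded: compactness makes only the other eigenspaces finite-dimensional.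
  let E : {s : ℝ // s ≠ 0} → Submodule ℝ H := fun s => Module.End.eigenspace (A : H →ₗ[ℝ] H) s
  have hfd : ∀ s, FiniteDimensional ℝ (E s) := fun s =>
    ContinuousLinearMap.finite_dimensional_eigenspace hA _ s.2
  have hof : OrthogonalFamily ℝ (fun s => E s) fun s => (E s).subtypeₗᵢ :=
    hsym.orthogonalFamily_eigenspaces.comp Subtype.val_injective
  let w : (Σ s : {s : ℝ // s ≠ 0}, Fin (Module.finrank ℝ (E s))) → H :=
    fun i => (stdOrthonormalBasis ℝ (E i.1) i.2 : H)
  have hw : Orthonormal ℝ w :=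
    hof.orthonormal_sigma_orthonormal (fun s => (stdOrthonormalBasis ℝ (E s)).orthonormal)
  have hAw : ∀ i, A (w i) = (i.1 : ℝ) • w i := fun i =>
    Module.End.mem_eigenspace_iff.1 (stdOrthonormalBasis ℝ (E i.1) i.2).2
  have hpos : ∀ i : (Σ s : {s : ℝ // s ≠ 0}, Fin (Module.finrank ℝ (E s))), 0 < (i.1 : ℝ) := by
    intro i
    have h := hnn (w i)
    rw [hAw, inner_smul_left, real_inner_self_eq_norm_sq, hw.1] at h
    exact lt_of_le_of_ne (by simpa using h) i.1.2.symm
  have hnorm : ∀ i, ‖A (w i)‖ = i.1 := fun i => by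
    rw [hAw, norm_smul, hw.1, mul_one, Real.norm_of_nonneg (hpos i).le]
  have hfin : ∀ ε > 0, {i : (Σ s : {s : ℝ // s ≠ 0}, Fin (Module.finrank ℝ (E s))) |
      ε ≤ (i.1 : ℝ)}.Finite := by
    intro ε hε
    -- Infinitely many eigenvalues above ε would give an orthonormal sequence whose images do not
    -- tend to 0.
    by_contra hcon
    have hcon : Set.Infinite _ := hcon
    let f := hcon.natEmbedding
    have h1 := tendsto_zero_of_isCompactOperator hA hs (hw.comp (fun n => (f n).1)
      (fun a b hab => f.injective (Subtype.ext hab)))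
    have h2 := h1.norm
    simp only [Function.comp, hnorm, norm_zero] at h2
    exact absurd (ge_of_tendsto' h2 fun n => (f n).2) (not_le.2 hε)
  have hker : (Submodule.span ℝ (Set.range w))ᗮ = LinearMap.ker (A : H →ₗ[ℝ] H) := by
    ext x
    rw [mem_orthogonal_span_range, LinearMap.mem_ker]
    constructor
    · intro hx
      have hxE : ∀ (s : {s : ℝ // s ≠ 0}) (z : H), z ∈ E s → inner ℝ z x = 0 := by
        intro s z hz
        have : z = ∑ j, (stdOrthonormalBasis ℝ (E s)).repr ⟨z, hz⟩ j •
            (stdOrthonormalBasis ℝ (E s) j : H) := by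
          have := congrArg (fun y : E s => (y : H)) ((stdOrthonormalBasis ℝ (E s)).sum_repr ⟨z, hz⟩)
          simpa using this.symm
        rw [this, sum_inner]
        refine Finset.sum_eq_zero fun j _ => ?_
        rw [inner_smul_left, hx ⟨s, j⟩, mul_zero]
      -- `A x` is orthogonal to every eigenspace: by `hxE` for a nonzero eigenvalue, by symmetry on
      -- the kernel. These spaces span a dense subspace, so `A x = 0`.
      have hmem : A x ∈ (⨆ μ, Module.End.eigenspace (A : H →ₗ[ℝ] H) μ)ᗮ := by
        rw [← Submodule.iInf_orthogonal, Submodule.mem_iInf]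
        intro μ
        rw [Submodule.mem_orthogonal]
        intro z hz
        have hz' : A z = μ • z := Module.End.mem_eigenspace_iff.1 hz
        have : inner ℝ z (A x) = inner ℝ (A z) x := (hsym z x).symm
        rw [this, hz', inner_smul_left]
        by_cases hμ : μ = 0
        · simp [hμ]
        · rw [hxE ⟨μ, hμ⟩ z hz, mul_zero]
      rw [ContinuousLinearMap.orthogonalComplement_iSup_eigenspaces_eq_bot hA hsym] at hmem
      exact hmem
    · intro hx i
      have h1 : inner ℝ (A (w i)) x = inner ℝ (w i) (A x) := hsym (w i) x
      have h2 : A x = 0 := hx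
      rw [hAw, inner_smul_left, h2, inner_zero_right] at h1
      exact (mul_eq_zero.1 h1).resolve_left (hpos i).ne'
  have hclos : (Submodule.span ℝ (Set.range w)).topologicalClosure =
      (LinearMap.ker (A : H →ₗ[ℝ] H))ᗮ := by
    rw [← hker, Submodule.orthogonal_orthogonal_eq_closure]
  have : Infinite (Σ s : {s : ℝ // s ≠ 0}, Fin (Module.finrank ℝ (E s))) := by
    by_contra hcon
    rw [not_infinite_iff_finite] at hcon
    have := FiniteDimensional.span_of_finite ℝ (Set.finite_range w)
    rw [← hclos, IsClosed.submodule_topologicalClosure_eq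
      (Submodule.closed_of_finiteDimensional _)] at hinf
    exact hinf this
  obtain ⟨e, he⟩ := exists_equiv_nat_antitone _ hpos hfin
  have hwe : Orthonormal ℝ (w ∘ e) := hw.comp _ e.injective
  refine ⟨w ∘ e, _, hwe, he, fun n => hpos _, ?_, fun n => hAw _, ?_⟩
  · have := (tendsto_zero_of_isCompactOperator hA hs hwe).norm
    simp only [Function.comp, hnorm, norm_zero] at this
    exact this
  · rw [Set.range_comp, e.range_eq_univ, Set.image_univ, hclos]

/-- Sequential Banach–Alaoglu, carried over to `H` by the Riesz isomorphism. -/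
theorem exists_weak_limit [CompleteSpace H] [TopologicalSpace.SeparableSpace H] {x : ℕ → H}
    {C : ℝ} (hx : ∀ n, ‖x n‖ ≤ C) :
    ∃ (y : H) (φ : ℕ → ℕ), StrictMono φ ∧ ‖y‖ ≤ C ∧
      ∀ z, Tendsto (fun n => inner ℝ (x (φ n)) z) atTop (𝓝 (inner ℝ y z)) := by
  obtain ⟨f, hf, φ, hφ, hlim⟩ := WeakDual.isSeqCompact_closedBall ℝ H 0 C
    (x := fun n => StrongDual.toWeakDual (InnerProductSpace.toDual ℝ H (x n)))
    (fun n => by simpa using hx n)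
  refine ⟨(InnerProductSpace.toDual ℝ H).symm (WeakDual.toStrongDual f), φ, hφ, ?_, fun z => ?_⟩
  · simpa using hf
  · have := ((WeakDual.eval_continuous z).tendsto f).comp hlim
    rw [InnerProductSpace.toDual_symm_apply]
    exact this

/-- An operator on a separable Hilbert space which maps weakly null bounded sequences to null
sequences is compact. -/
theorem isCompactOperator_of_weakly_null [CompleteSpace H] [TopologicalSpace.SeparableSpace H]
    {W : Type*} [NormedAddCommGroup W] [NormedSpace ℝ W] (J : H →L[ℝ] W)
    (h : ∀ (x : ℕ → H) (C : ℝ), (∀ n, ‖x n‖ ≤ C) →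
      (∀ z, Tendsto (fun n => inner ℝ (x n) z) atTop (𝓝 0)) →
      Tendsto (fun n => J (x n)) atTop (𝓝 0)) : IsCompactOperator J := by
  refine ⟨J '' Metric.closedBall 0 1, ?_, Filter.mem_of_superset
    (Metric.closedBall_mem_nhds 0 one_pos) (Set.subset_preimage_image _ _)⟩
  refine IsSeqCompact.isCompact fun u hu => ?_
  choose x hx hxu using hu
  obtain ⟨y, φ, hφ, hy, hlim⟩ := exists_weak_limit (x := x) (C := 1) (fun n => by simpa using hx n)
  refine ⟨J y, ⟨y, by simpa using hy, rfl⟩, φ, hφ, ?_⟩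
  have := h (fun n => x (φ n) - y) (1 + 1)
    (fun n => (norm_sub_le _ _).trans (add_le_add (by simpa using hx (φ n)) hy))
    (fun z => by
      simp_rw [inner_sub_left]
      simpa using (hlim z).sub_const (inner ℝ y z))
  simp_rw [map_sub, hxu] at this
  have h2 := this.add_const (J y)
  simp only [sub_add_cancel, zero_add] at h2
  exact h2

/-! ### Operators that are diagonal with respect to two orthonormal sequences. -/

section Diagonal

variable {H' : Type*} [NormedAddCommGroup H'] [InnerProductSpace ℝ H']
  {e : ℕ → H} {f : ℕ → H'} {a : ℕ → ℝ} {C : ℝ}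

theorem norm_sum_smul_sq (hf : Orthonormal ℝ f) (c : ℕ → ℝ) (s : Finset ℕ) :
    ‖∑ k ∈ s, c k • f k‖ ^ 2 = ∑ k ∈ s, c k ^ 2 := by
  rw [← real_inner_self_eq_norm_sq, hf.inner_sum]
  simp [sq]

theorem norm_le_of_hasSum_diagonal (he : Orthonormal ℝ e) (hf : Orthonormal ℝ f)
    (ha : ∀ k, |a k| ≤ C) {x : H} {y : H'}
    (hy : HasSum (fun k => (a k * inner ℝ (e k) x) • f k) y) : ‖y‖ ≤ C * ‖x‖ := by
  have hC : 0 ≤ C := (abs_nonneg _).trans (ha 0)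
  refine le_of_tendsto' hy.norm fun s => ?_
  refine abs_le_of_sq_le_sq' ?_ (by positivity) |>.2
  rw [norm_sum_smul_sq hf, mul_pow]
  calc ∑ k ∈ s, (a k * inner ℝ (e k) x) ^ 2 ≤ ∑ k ∈ s, C ^ 2 * ‖inner ℝ (e k) x‖ ^ 2 := by
        refine Finset.sum_le_sum fun k _ => ?_
        rw [mul_pow, Real.norm_eq_abs, sq_abs]
        exact mul_le_mul_of_nonneg_right (sq_le_sq' (abs_le.1 (ha k)).1 (abs_le.1 (ha k)).2)
          (sq_nonneg _)
    _ = C ^ 2 * ∑ k ∈ s, ‖inner ℝ (e k) x‖ ^ 2 := by rw [Finset.mul_sum]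
    _ ≤ C ^ 2 * ‖x‖ ^ 2 := by
        gcongr
        exact he.sum_inner_products_le x

theorem summable_smul_orthonormal [CompleteSpace H'] (hf : Orthonormal ℝ f) {c : ℕ → ℝ}
    (hc : Summable fun k => c k ^ 2) : Summable fun k => c k • f k := by
  have := (hf.orthogonalFamily.summable_iff_norm_sq_summable c).2 (by simpa using hc)
  simpa using this

/-- The target sequence may live in another space: besides the inverse square root itself, this
builds the gradient of its values, with `f` the normalized gradients of eigenfunctions. -/
theorem exists_diagonal [CompleteSpace H'] (he : Orthonormal ℝ e) (hf : Orthonormal ℝ f)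
    (ha : ∀ k, |a k| ≤ C) :
    ∃ T : H →L[ℝ] H', ∀ x, HasSum (fun k => (a k * inner ℝ (e k) x) • f k) (T x) := by
  have hsum : ∀ x, Summable (fun k => (a k * inner ℝ (e k) x) • f k) := fun x => by
    refine summable_smul_orthonormal hf ?_
    refine Summable.of_nonneg_of_le (fun _ => sq_nonneg _) (fun k => ?_)
      ((he.inner_products_summable x).mul_left (C ^ 2))
    rw [mul_pow, Real.norm_eq_abs, sq_abs]
    exact mul_le_mul_of_nonneg_right (sq_le_sq' (abs_le.1 (ha k)).1 (abs_le.1 (ha k)).2)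
      (sq_nonneg _)
  let T : H →ₗ[ℝ] H' :=
    { toFun := fun x => ∑' k, (a k * inner ℝ (e k) x) • f k
      map_add' := fun x y => by
        rw [← (hsum x).tsum_add (hsum y)]
        simp only [inner_add_right, mul_add, add_smul]
      map_smul' := fun c x => by
        rw [RingHom.id_apply, ← (hsum x).tsum_const_smul c]
        refine tsum_congr fun k => ?_
        rw [inner_smul_right, smul_smul]
        ring_nf }
  exact ⟨T.mkContinuous C fun x => norm_le_of_hasSum_diagonal he hf ha (hsum x).hasSum,
    fun x => (hsum x).hasSum⟩

/-- A norm limit of finite-rank truncations. -/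
theorem isCompactOperator_of_diagonal [CompleteSpace H'] (he : Orthonormal ℝ e)
    (hf : Orthonormal ℝ f) (ha : Tendsto a atTop (𝓝 0)) {T : H →L[ℝ] H'}
    (hT : ∀ x, HasSum (fun k => (a k * inner ℝ (e k) x) • f k) (T x)) : IsCompactOperator T := by
  let F : ℕ → H →L[ℝ] H' := fun N =>
    ∑ k ∈ Finset.range N, a k • (innerSL ℝ (e k)).smulRight (f k)
  have hF : ∀ N x, F N x = ∑ k ∈ Finset.range N, (a k * inner ℝ (e k) x) • f k := fun N x => by
    simp [F, smul_smul]
  have hFc : ∀ N, IsCompactOperator (F N) := fun N => by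
    induction N with
    | zero => simpa [F] using (isCompactOperator_zero (M₁ := H) (M₂ := H'))
    | succ n ih =>
      have h1 : F (n + 1) = F n + a n • (innerSL ℝ (e n)).smulRight (f n) := by
        simp [F, Finset.sum_range_succ]
      rw [h1]
      refine ih.add (IsCompactOperator.smul ?_ (a n))
      have : ((innerSL ℝ (e n)).smulRight (f n) : H →L[ℝ] H') =
          (ContinuousLinearMap.toSpanSingleton ℝ (f n)).comp (innerSL ℝ (e n)) := by
        ext x; simp
      rw [this]
      exact IsCompactOperator.comp_clm
        (isCompactOperator_of_locallyCompactSpace_rng (ContinuousLinearMap.toSpanSingleton ℝ (f n)))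
        (innerSL ℝ (e n))
  refine isCompactOperator_of_tendsto (F := F) (l := atTop) ?_ (Eventually.of_forall hFc)
  rw [Metric.tendsto_atTop]
  intro ε hε
  obtain ⟨N, hN⟩ := Metric.tendsto_atTop.1 ha (ε / 2) (half_pos hε)
  refine ⟨N, fun n hn => ?_⟩
  rw [dist_eq_norm']
  refine lt_of_le_of_lt (ContinuousLinearMap.opNorm_le_bound _ (half_pos hε).le fun x => ?_)
    (half_lt_self hε)
  -- `T - F n` is again diagonal, with the first n coefficients replaced by 0.
  refine norm_le_of_hasSum_diagonal (a := fun k => if k < n then 0 else a k) he hf (fun k => ?_) ?_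
  · split_ifs with h
    · simpa using (half_pos hε).le
    · have := hN k (hn.trans (not_lt.1 h))
      rw [Real.dist_eq, sub_zero] at this
      exact this.le
  · have h2 : HasSum (fun k => if k < n then (a k * inner ℝ (e k) x) • f k else 0) (F n x) := by
      rw [hF]
      have : HasSum (fun k => if k < n then (a k * inner ℝ (e k) x) • f k else 0)
          (∑ k ∈ Finset.range n, if k < n then (a k * inner ℝ (e k) x) • f k else 0) :=
        hasSum_sum_of_ne_finset_zero fun b hb => if_neg (by simpa using hb)
      convert this using 1
      exact Finset.sum_congr rfl fun k hk => (if_pos (by simpa using hk)).symm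
    convert (hT x).sub h2 using 2 with k
    split_ifs <;> simp
    rfl

end Diagonal

end Hilbert

end

/-! ### Test functions and the translation estimate. -/

section

variable {d : ℕ}

/-- Test functions: smooth functions with compact support in `A`. -/
structure IsTest (A : Set (Eucl d)) (ψ : Eucl d → ℝ) : Prop where
  contDiff : ContDiff ℝ ∞ ψ
  compact : HasCompactSupport ψ
  subset : tsupport ψ ⊆ A

namespace IsTest

variable {A : Set (Eucl d)} {ψ : Eucl d → ℝ}

theorem continuous (h : IsTest A ψ) : Continuous ψ := h.contDiff.continuous

theorem continuous_fderiv (h : IsTest A ψ) : Continuous (fderiv ℝ ψ) :=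
  h.contDiff.continuous_fderiv (by simp)

theorem memLp (h : IsTest A ψ) (μ : Measure (Eucl d)) [IsFiniteMeasureOnCompacts μ] :
    MemLp ψ 2 μ :=
  h.continuous.memLp_of_hasCompactSupport h.compact

theorem memLp_smul (h : IsTest A ψ) (μ : Measure (Eucl d)) [IsFiniteMeasureOnCompacts μ]
    (e : Eucl d) : MemLp (fun x => ψ x • e) 2 μ :=
  (h.continuous.smul continuous_const).memLp_of_hasCompactSupport h.compact.smul_right

theorem memLp_fderiv (h : IsTest A ψ) (μ : Measure (Eucl d)) [IsFiniteMeasureOnCompacts μ]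
    (e : Eucl d) : MemLp (fun x => fderiv ℝ ψ x e) 2 μ :=
  (h.continuous_fderiv.clm_apply continuous_const).memLp_of_hasCompactSupport
    (h.compact.fderiv_apply ℝ e)

theorem apply_eq_zero (h : IsTest A ψ) {x : Eucl d} (hx : x ∉ A) : ψ x = 0 :=
  image_eq_zero_of_notMem_tsupport fun hx' => hx (h.subset hx')

theorem fderiv_eq_zero (h : IsTest A ψ) {x : Eucl d} (hx : x ∉ A) : fderiv ℝ ψ x = 0 :=
  image_eq_zero_of_notMem_tsupport fun hx' => hx (h.subset (tsupport_fderiv_subset ℝ hx'))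

theorem translate (h : IsTest A ψ) {B : Set (Eucl d)} {v : Eucl d} (hAB : ∀ x ∈ A, x + v ∈ B) :
    IsTest B (fun x => ψ (x - v)) where
  contDiff := h.contDiff.comp (contDiff_id.sub contDiff_const)
  compact := h.compact.comp_homeomorph (Homeomorph.subRight v)
  subset := by
    have : tsupport (fun x => ψ (x - v)) = (Homeomorph.subRight v) ⁻¹' tsupport ψ :=
      tsupport_comp_eq_preimage ψ (Homeomorph.subRight v)
    rw [this]
    intro x hx
    have := hAB _ (h.subset hx)
    simpa using this

end IsTest

theorem norm_toLp_sq {α : Type*} [MeasurableSpace α] {μ : Measure α} {f : α → ℝ}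
    (hf : MemLp f 2 μ) : ‖hf.toLp f‖ ^ 2 = ∫ x, f x ^ 2 ∂μ := by
  rw [← real_inner_self_eq_norm_sq, L2.inner_def]
  refine integral_congr_ae ?_
  filter_upwards [hf.coeFn_toLp] with x hx
  simp [hx, sq]

theorem lintegral_ofReal_sq {α : Type*} [MeasurableSpace α] {μ : Measure α} {f : α → ℝ}
    (hf : MemLp f 2 μ) : ∫⁻ x, ENNReal.ofReal (f x ^ 2) ∂μ = ENNReal.ofReal (‖hf.toLp f‖ ^ 2) := by
  rw [norm_toLp_sq, ofReal_integral_eq_lintegral_ofReal hf.integrable_sq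
    (Eventually.of_forall fun _ => sq_nonneg _)]

theorem lintegral_ofReal_coe_sq {α : Type*} [MeasurableSpace α] {μ : Measure α}
    (f : Lp ℝ 2 μ) : ∫⁻ x, ENNReal.ofReal (f x ^ 2) ∂μ = ENNReal.ofReal (‖f‖ ^ 2) := by
  rw [lintegral_ofReal_sq (Lp.memLp f), Lp.toLp_coeFn]

theorem inner_toLp {α : Type*} [MeasurableSpace α] {μ : Measure α} {f : α → ℝ}
    (hf : MemLp f 2 μ) (u : Lp ℝ 2 μ) : inner ℝ (hf.toLp f) u = ∫ x, u x * f x ∂μ := by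
  rw [L2.inner_def]
  refine integral_congr_ae ?_
  filter_upwards [hf.coeFn_toLp] with x hx
  simp [hx]

theorem inner_L2_eq {α : Type*} [MeasurableSpace α] {μ : Measure α} (f u : Lp ℝ 2 μ) :
    inner ℝ f u = ∫ x, f x * u x ∂μ := by
  rw [L2.inner_def]
  refine integral_congr_ae (Eventually.of_forall fun x => ?_)
  simp [mul_comm]

theorem setIntegral_eq_integral_of_ae {E : Type*} [NormedAddCommGroup E] [NormedSpace ℝ E]
    {A : Set (Eucl d)} {f g : Eucl d → E} (h : f =ᵐ[volume.restrict A] g)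
    (hg : ∀ x, x ∉ A → g x = 0) : ∫ x in A, f x = ∫ x, g x :=
  (integral_congr_ae h).trans (setIntegral_eq_integral_of_forall_compl_eq_zero hg)

/-- The span of the test functions in `L²(A)`. -/
def testSpan (A : Set (Eucl d)) : Submodule ℝ (L2 A) :=
  Submodule.span ℝ {f | ∃ (ψ : Eucl d → ℝ) (h : IsTest A ψ), f = (h.memLp _).toLp ψ}

theorem testSpan_orthogonal {A : Set (Eucl d)} (hA : IsOpen A) : (testSpan A)ᗮ = ⊥ := by
  rw [eq_bot_iff]
  intro w hw
  rw [Submodule.mem_orthogonal] at hw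
  rw [Submodule.mem_bot, Lp.eq_zero_iff_ae_eq_zero]
  have hloc : LocallyIntegrableOn (w : Eucl d → ℝ) A volume :=
    locallyIntegrableOn_of_locallyIntegrable_restrict ((Lp.memLp w).locallyIntegrable (by simp))
  have := hA.ae_eq_zero_of_integral_contDiff_smul_eq_zero hloc (fun ψ h1 h2 h3 => by
    have ht : IsTest A ψ := ⟨h1, h2, h3⟩
    have h := hw _ (Submodule.subset_span ⟨ψ, ht, rfl⟩)
    rw [inner_toLp] at h
    rw [← h, ← setIntegral_eq_integral_of_forall_compl_eq_zero (s := A)]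
    · simp [mul_comm]
    · intro x hx
      simp [ht.apply_eq_zero hx])
  rw [EventuallyEq, ae_restrict_iff' hA.measurableSet]
  exact this

theorem testSpan_dense {A : Set (Eucl d)} (hA : IsOpen A) :
    (testSpan A).topologicalClosure = ⊤ := by
  rw [← Submodule.orthogonal_orthogonal_eq_closure, testSpan_orthogonal hA,
    Submodule.bot_orthogonal_eq_top]

/-- Duality: the bound ⟨w, v⟩ ≤ C‖v‖ extends from the dense test functions to v = w. -/
theorem lintegral_sq_le_of_test {A : Set (Eucl d)} (hA : IsOpen A) {f : Eucl d → ℝ}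
    (hf : MemLp f 2 (volume.restrict A)) {C : ℝ} (hC : 0 ≤ C)
    (h : ∀ ψ, IsTest A ψ → |∫ x in A, f x * ψ x| ≤ C * (eLpNorm ψ 2 volume).toReal) :
    ∫⁻ x in A, ENNReal.ofReal (f x ^ 2) ≤ ENNReal.ofReal (C ^ 2) := by
  rw [lintegral_ofReal_sq hf]
  set w := hf.toLp f with hw
  have hspan : ∀ v ∈ testSpan A, ∃ (ψ : Eucl d → ℝ) (h : IsTest A ψ), v = (h.memLp _).toLp ψ := by
    intro v hv
    induction hv using Submodule.span_induction with
    | mem v hv => exact hv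
    | zero =>
      have h0 : IsTest A (0 : Eucl d → ℝ) :=
        ⟨contDiff_const, HasCompactSupport.zero, by simp⟩
      exact ⟨0, h0, (MemLp.toLp_zero _).symm⟩
    | add a b _ _ ha hb =>
      obtain ⟨ψ, hψ, rfl⟩ := ha
      obtain ⟨η, hη, rfl⟩ := hb
      exact ⟨ψ + η, ⟨hψ.contDiff.add hη.contDiff, hψ.compact.add hη.compact,
        (tsupport_add ψ η).trans (Set.union_subset hψ.subset hη.subset)⟩,
        (MemLp.toLp_add _ _).symm⟩
    | smul c a _ ha =>
      obtain ⟨ψ, hψ, rfl⟩ := ha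
      exact ⟨c • ψ, ⟨hψ.contDiff.const_smul c, hψ.compact.smul_left (f := fun _ => c),
        (tsupport_smul_subset_right (fun _ => c) ψ).trans hψ.subset⟩,
        (MemLp.toLp_const_smul c _).symm⟩
  have hbound : ∀ v ∈ testSpan A, inner ℝ w v ≤ C * ‖v‖ := by
    intro v hv
    obtain ⟨ψ, hψ, rfl⟩ := hspan v hv
    rw [real_inner_comm, inner_toLp, Lp.norm_toLp,
      eLpNorm_restrict_eq_of_support_subset (subset_closure.trans hψ.subset)]
    refine le_trans (le_of_eq ?_) ((le_abs_self _).trans (h ψ hψ))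
    refine integral_congr_ae ?_
    filter_upwards [hf.coeFn_toLp] with x hx
    rw [hw, hx]
  have hclosed : IsClosed {v : L2 A | inner ℝ w v ≤ C * ‖v‖} :=
    isClosed_le (by fun_prop) (by fun_prop)
  have hmem : w ∈ (testSpan A).topologicalClosure := by rw [testSpan_dense hA]; trivial
  have hww : inner ℝ w w ≤ C * ‖w‖ :=
    closure_minimal (show (testSpan A : Set (L2 A)) ⊆ _ from hbound) hclosed hmem
  rw [real_inner_self_eq_norm_sq] at hww
  refine ENNReal.ofReal_le_ofReal ?_
  have hw0 := norm_nonneg w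
  have : ‖w‖ ≤ C := by
    by_contra hcon
    push Not at hcon
    nlinarith
  gcongr

/-- Translation estimate: if the distributional gradient of `f` is bounded by `N` in `L²(Ω)`, then
`‖f(· + h) - f‖_{L²(A)} ≤ ‖h‖ N` as soon as the segments `[x, x + h]`, `x ∈ A`, lie in `Ω`. -/
theorem translation_estimate {Ω A : Set (Eucl d)} (hA : IsOpen A) {f : Eucl d → ℝ}
    (hf : MemLp f 2 volume) (hfi : Integrable f) {N : ℝ} (hN : 0 ≤ N)
    (hgrad : ∀ ψ, IsTest Ω ψ → ∀ e : Eucl d,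
      |∫ x, f x * fderiv ℝ ψ x e| ≤ N * ‖e‖ * (eLpNorm ψ 2 volume).toReal)
    {h : Eucl d} (hAh : ∀ x ∈ A, ∀ t ∈ Set.Icc (0 : ℝ) 1, x + t • h ∈ Ω) :
    ∫⁻ x in A, ENNReal.ofReal ((f (x + h) - f x) ^ 2) ≤ ENNReal.ofReal ((N * ‖h‖) ^ 2) := by
  have hfh : MemLp (fun x => f (x + h)) 2 volume :=
    hf.comp_measurePreserving (measurePreserving_add_right volume h)
  refine lintegral_sq_le_of_test hA ((hfh.sub hf).mono_measure Measure.restrict_le_self)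
    (by positivity) fun ψ hψ => ?_
  -- `F 1 - F 0` is the integral to be bounded. For t in [0, 1] the translate of ψ is still a test
  -- function in Ω, so `hgrad` bounds `F'` and the mean value inequality concludes.
  set F : ℝ → ℝ := fun t => ∫ x, f x * ψ (x - t • h) with hF
  obtain ⟨M, hM⟩ := (hψ.compact.fderiv ℝ).exists_bound_of_continuous hψ.continuous_fderiv
  have hdiff : Differentiable ℝ ψ := hψ.contDiff.differentiable (by simp)
  have hderiv : ∀ t, HasDerivAt F (∫ x, f x * fderiv ℝ ψ (x - t • h) (-h)) t := by
    intro t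
    refine (hasDerivAt_integral_of_dominated_loc_of_deriv_le (μ := volume)
      (F := fun t x => f x * ψ (x - t • h))
      (F' := fun t x => f x * fderiv ℝ ψ (x - t • h) (-h))
      (bound := fun x => ‖f x‖ * (M * ‖h‖)) (s := Set.univ) Filter.univ_mem
      (Eventually.of_forall fun s => ?_) ?_ ?_ ?_ ?_ ?_).2
    · exact hfi.aestronglyMeasurable.mul
        (hψ.continuous.comp (by fun_prop)).aestronglyMeasurable
    · obtain ⟨B, hB⟩ := hψ.compact.exists_bound_of_continuous hψ.continuous
      exact hfi.mul_bdd (c := B) (hψ.continuous.comp (by fun_prop)).aestronglyMeasurable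
        (Eventually.of_forall fun x => hB _)
    · exact hfi.aestronglyMeasurable.mul ((hψ.continuous_fderiv.comp (by fun_prop)).clm_apply
        continuous_const).aestronglyMeasurable
    · refine Eventually.of_forall fun x s _ => ?_
      rw [norm_mul]
      gcongr
      refine ((fderiv ℝ ψ (x - s • h)).le_opNorm (-h)).trans ?_
      rw [norm_neg]
      gcongr
      exact hM _
    · exact hfi.norm.mul_const _
    · refine Eventually.of_forall fun x s _ => ?_
      have h1 : HasDerivAt (fun s : ℝ => x - s • h) (-h) s := by
        simpa using ((hasDerivAt_id s).smul_const h).const_sub x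
      exact ((hdiff (x - s • h)).hasFDerivAt.comp_hasDerivAt s h1).const_mul (f x)
  have hbd : ∀ t ∈ Set.Ico (0 : ℝ) 1, ‖∫ x, f x * fderiv ℝ ψ (x - t • h) (-h)‖ ≤
      N * ‖h‖ * (eLpNorm ψ 2 volume).toReal := by
    intro t ht
    have ht' : IsTest Ω (fun x => ψ (x - t • h)) :=
      hψ.translate fun x hx => hAh x hx t ⟨ht.1, ht.2.le⟩
    have h1 := hgrad _ ht' (-h)
    have h2 : eLpNorm (fun x => ψ (x - t • h)) 2 volume = eLpNorm ψ 2 volume :=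
      eLpNorm_comp_measurePreserving hψ.continuous.aestronglyMeasurable
        (measurePreserving_sub_right volume (t • h))
    rw [h2, norm_neg] at h1
    have h3 : ∀ x, fderiv ℝ (fun x => ψ (x - t • h)) x = fderiv ℝ ψ (x - t • h) := fun x => by
      simpa only [sub_eq_add_neg] using fderiv_comp_add_right (𝕜 := ℝ) (f := ψ) (x := x) (-(t • h))
    simp_rw [h3] at h1
    exact h1
  have hF10 := norm_image_sub_le_of_norm_deriv_le_segment_01'
    (fun t _ => (hderiv t).hasDerivWithinAt) hbd
  refine le_trans (le_of_eq ?_) hF10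
  rw [Real.norm_eq_abs]
  congr 1
  have hF1 : F 1 = ∫ x, f (x + h) * ψ x := by
    have := integral_add_right_eq_self (μ := volume) (fun x => f x * ψ (x - (1 : ℝ) • h)) h
    simp only [one_smul, add_sub_cancel_right] at this
    simp [hF, this]
  have hF0 : F 0 = ∫ x, f x * ψ x := by simp [hF]
  have hψi := hψ.memLp volume
  have hsub : ∫ x, (f (x + h) * ψ x - f x * ψ x) =
      (∫ x, f (x + h) * ψ x) - ∫ x, f x * ψ x :=
    integral_sub (hfh.integrable_mul hψi) (hf.integrable_mul hψi)
  rw [hF1, hF0, ← hsub]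
  refine setIntegral_eq_integral_of_ae (Eventually.of_forall fun x => ?_) fun x hx => ?_
  · simp [sub_mul]
  · simp [hψ.apply_eq_zero hx]

/-! ### Weak gradients and H¹(Ω). -/

section WeakGradient

variable {Ω : Set (Eucl d)}

theorem inner_toLp_smul {ψ : Eucl d → ℝ} (h : IsTest Ω ψ) (e : Eucl d) (g : L2Vec Ω) :
    inner ℝ ((h.memLp_smul (volume.restrict Ω) e).toLp _) g =
      ∫ x in Ω, inner ℝ (g x) e * ψ x := by
  rw [L2.inner_def]
  refine integral_congr_ae ?_
  filter_upwards [(h.memLp_smul (volume.restrict Ω) e).coeFn_toLp] with x hx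
  rw [hx, inner_smul_left, real_inner_comm]
  simp [mul_comm]

/-- Written as inner products with fixed L² elements, the condition is visibly linear and closed in
the pair `(u, g)`. -/
theorem isWeakGradient_iff {u : L2 Ω} {g : L2Vec Ω} :
    IsWeakGradient Ω u g ↔ ∀ (ψ : Eucl d → ℝ) (h : IsTest Ω ψ) (e : Eucl d),
      inner ℝ ((h.memLp_fderiv (volume.restrict Ω) e).toLp _) u =
        - inner ℝ ((h.memLp_smul (volume.restrict Ω) e).toLp _) g := by
  refine ⟨fun H ψ h e => ?_, fun H ψ h1 h2 h3 e => ?_⟩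
  · rw [inner_toLp_smul h, inner_toLp]
    exact H ψ h.contDiff h.compact h.subset e
  · have := H ψ ⟨h1, h2, h3⟩ e
    rwa [inner_toLp_smul ⟨h1, h2, h3⟩, inner_toLp] at this

variable (Ω) in
/-- `H¹(Ω)`, as the graph of the weak gradient. -/
def sobolev : Submodule ℝ (WithLp 2 (L2 Ω × L2Vec Ω)) where
  carrier := {p | IsWeakGradient Ω p.fst p.snd}
  zero_mem' := isWeakGradient_iff.2 fun ψ h e => by
    change inner ℝ _ (0 : L2 Ω) = - inner ℝ _ (0 : L2Vec Ω)
    simp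
  add_mem' {p q} hp hq := isWeakGradient_iff.2 fun ψ h e => by
    change inner ℝ _ (p.fst + q.fst) = - inner ℝ _ (p.snd + q.snd)
    rw [inner_add_right, inner_add_right, isWeakGradient_iff.1 hp ψ h e,
      isWeakGradient_iff.1 hq ψ h e]
    ring
  smul_mem' c p hp := isWeakGradient_iff.2 fun ψ h e => by
    change inner ℝ _ (c • p.fst) = - inner ℝ _ (c • p.snd)
    rw [inner_smul_right, inner_smul_right, isWeakGradient_iff.1 hp ψ h e]
    ring

theorem mem_sobolev {p : WithLp 2 (L2 Ω × L2Vec Ω)} :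
    p ∈ sobolev Ω ↔ IsWeakGradient Ω p.fst p.snd := Iff.rfl

theorem isClosed_sobolev : IsClosed (sobolev Ω : Set (WithLp 2 (L2 Ω × L2Vec Ω))) := by
  have : (sobolev Ω : Set (WithLp 2 (L2 Ω × L2Vec Ω))) =
      ⋂ (ψ : Eucl d → ℝ) (h : IsTest Ω ψ) (e : Eucl d),
        {p | inner ℝ ((h.memLp_fderiv (volume.restrict Ω) e).toLp _) p.fst =
          - inner ℝ ((h.memLp_smul (volume.restrict Ω) e).toLp _) p.snd} := by
    ext p
    simp only [SetLike.mem_coe, mem_sobolev, isWeakGradient_iff, Set.mem_iInter]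
    rfl
  rw [this]
  refine isClosed_iInter fun ψ => isClosed_iInter fun h => isClosed_iInter fun e => ?_
  have h1 : Continuous fun p : WithLp 2 (L2 Ω × L2Vec Ω) => p.fst :=
    (WithLp.prod_continuous_ofLp 2 _ _).fst
  have h2 : Continuous fun p : WithLp 2 (L2 Ω × L2Vec Ω) => p.snd :=
    (WithLp.prod_continuous_ofLp 2 _ _).snd
  exact isClosed_eq (continuous_const.inner h1) (continuous_const.inner h2).neg

theorem IsWeakGradient.sub {u v : L2 Ω} {g h : L2Vec Ω} (hu : IsWeakGradient Ω u g)
    (hv : IsWeakGradient Ω v h) : IsWeakGradient Ω (u - v) (g - h) :=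
  (sobolev Ω).sub_mem (x := WithLp.toLp 2 (u, g)) (y := WithLp.toLp 2 (v, h)) hu hv

theorem IsWeakGradient.smul {u : L2 Ω} {g : L2Vec Ω} (c : ℝ) (hu : IsWeakGradient Ω u g) :
    IsWeakGradient Ω (c • u) (c • g) :=
  (sobolev Ω).smul_mem (x := WithLp.toLp 2 (u, g)) c hu

theorem IsWeakGradient.hasSum {ι : Type*} {u : ι → L2 Ω} {g : ι → L2Vec Ω} {U : L2 Ω}
    {G : L2Vec Ω} (h : ∀ i, IsWeakGradient Ω (u i) (g i)) (hu : HasSum u U) (hg : HasSum g G) :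
    IsWeakGradient Ω U G := by
  refine isWeakGradient_iff.2 fun ψ ht e => ?_
  have h1 := hu.mapL (innerSL ℝ ((ht.memLp_fderiv (volume.restrict Ω) e).toLp _))
  have h2 := (hg.mapL (innerSL ℝ ((ht.memLp_smul (volume.restrict Ω) e).toLp _))).neg
  have h3 : (fun i => inner ℝ ((ht.memLp_fderiv (volume.restrict Ω) e).toLp _) (u i)) = fun i =>
      - inner ℝ ((ht.memLp_smul (volume.restrict Ω) e).toLp _) (g i) :=
    funext fun i => isWeakGradient_iff.1 (h i) ψ ht e
  simp only [innerSL_apply_apply] at h1 h2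
  rw [h3] at h1
  exact h1.unique h2

/-- Integration by parts. It makes test functions admissible in weak equations, whence the
injectivity of the resolvent. -/
theorem IsTest.isWeakGradient {ψ : Eucl d → ℝ} (hψ : IsTest Ω ψ) :
    ∃ g : L2Vec Ω, IsWeakGradient Ω ((hψ.memLp _).toLp ψ) g := by
  have hg : MemLp (fun x => (InnerProductSpace.toDual ℝ (Eucl d)).symm (fderiv ℝ ψ x)) 2
      (volume.restrict Ω) := by
    refine Continuous.memLp_of_hasCompactSupport
      ((InnerProductSpace.toDual ℝ (Eucl d)).symm.continuous.comp hψ.continuous_fderiv) ?_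
    exact (hψ.compact.fderiv ℝ).comp_left (map_zero _)
  refine ⟨hg.toLp _, fun η h1 h2 h3 e => ?_⟩
  have hη : IsTest Ω η := ⟨h1, h2, h3⟩
  have hdψ : Differentiable ℝ ψ := hψ.contDiff.differentiable (by simp)
  have hdη : Differentiable ℝ η := hη.contDiff.differentiable (by simp)
  have e1 : ∫ x in Ω, (hψ.memLp (volume.restrict Ω)).toLp ψ x * fderiv ℝ η x e =
      ∫ x, ψ x * fderiv ℝ η x e := by
    refine setIntegral_eq_integral_of_ae ?_ fun x hx => by simp [hψ.apply_eq_zero hx]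
    filter_upwards [(hψ.memLp (volume.restrict Ω)).coeFn_toLp] with x hx
    rw [hx]
  have e2 : ∫ x in Ω, inner ℝ (hg.toLp _ x) e * η x = ∫ x, fderiv ℝ ψ x e * η x := by
    refine setIntegral_eq_integral_of_ae ?_ fun x hx => by simp [hη.apply_eq_zero hx]
    filter_upwards [hg.coeFn_toLp] with x hx
    rw [hx, InnerProductSpace.toDual_symm_apply]
  rw [e1, e2]
  exact integral_mul_fderiv_eq_neg_fderiv_mul_of_integrable
    ((hψ.memLp_fderiv volume e).integrable_mul (hη.memLp volume))
    ((hψ.memLp volume).integrable_mul (hη.memLp_fderiv volume e))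
    ((hψ.memLp volume).integrable_mul (hη.memLp volume)) (fun x _ => hdψ x) (fun x _ => hdη x)

theorem constL2_ae (hΩ : Bornology.IsBounded Ω) (c : ℝ) :
    constL2 hΩ c =ᵐ[volume.restrict Ω] fun _ => c :=
  MemLp.coeFn_toLp _

theorem isWeakGradient_constL2 (hΩ : Bornology.IsBounded Ω) (c : ℝ) :
    IsWeakGradient Ω (constL2 hΩ c) 0 := by
  intro ψ h1 h2 h3 e
  have ht : IsTest Ω ψ := ⟨h1, h2, h3⟩
  have hd : Differentiable ℝ ψ := h1.differentiable (by simp)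
  have e1 : ∫ x in Ω, constL2 hΩ c x * fderiv ℝ ψ x e = ∫ x, c * fderiv ℝ ψ x e := by
    refine setIntegral_eq_integral_of_ae ?_ fun x hx => by simp [ht.fderiv_eq_zero hx]
    filter_upwards [constL2_ae hΩ c] with x hx
    rw [hx]
  have e2 : ∫ x in Ω, inner ℝ ((0 : L2Vec Ω) x) e * ψ x = 0 := by
    refine integral_eq_zero_of_ae ?_
    filter_upwards [Lp.coeFn_zero (Eucl d) 2 (volume.restrict Ω)] with x hx
    rw [hx]
    simp
  rw [e1, e2, integral_mul_fderiv_eq_neg_fderiv_mul_of_integrable]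
  · simp
  · simp
  · exact (((ht.continuous_fderiv.clm_apply continuous_const).integrable_of_hasCompactSupport
      (ht.compact.fderiv_apply ℝ e))).const_mul c
  · exact (ht.continuous.integrable_of_hasCompactSupport ht.compact).const_mul c
  · intro x _; fun_prop
  · intro x _; exact hd x

end WeakGradient

end

/-! ### Extension by zero, functions with zero gradient, boundary strips. -/

section

variable {d : ℕ} {Ω : Set (Eucl d)}

/-- The extension by zero of a function in `L²(Ω)`. -/
def ext0 (u : L2 Ω) : Eucl d → ℝ := Ω.indicator u

theorem ext0_measurable (hΩ : IsOpen Ω) (u : L2 Ω) : Measurable (ext0 u) :=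
  (Lp.stronglyMeasurable u).measurable.indicator hΩ.measurableSet

theorem ext0_memLp (hΩ : IsOpen Ω) (u : L2 Ω) : MemLp (ext0 u) 2 volume :=
  (memLp_indicator_iff_restrict hΩ.measurableSet).2 (Lp.memLp u)

theorem ext0_integrable (hΩ : IsOpen Ω) (hb : Bornology.IsBounded Ω) (u : L2 Ω) :
    Integrable (ext0 u) := by
  have : IsFiniteMeasure (volume.restrict Ω) := isFiniteMeasure_restrict.2 hb.measure_lt_top.ne
  exact (integrable_indicator_iff hΩ.measurableSet).2 ((Lp.memLp u).integrable (by norm_num))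

theorem ext0_of_mem {u : L2 Ω} {x : Eucl d} (hx : x ∈ Ω) : ext0 u x = u x :=
  Set.indicator_of_mem hx _

theorem lintegral_ext0_sq (hΩ : IsOpen Ω) (u : L2 Ω) :
    ∫⁻ x, ENNReal.ofReal (ext0 u x ^ 2) = ENNReal.ofReal (‖u‖ ^ 2) := by
  rw [← lintegral_ofReal_coe_sq, ← lintegral_indicator hΩ.measurableSet]
  refine lintegral_congr fun x => ?_
  by_cases hx : x ∈ Ω <;> simp [ext0, hx]

/-- The extension by zero may jump across the boundary, but test functions supported in Ω see only
`g`, and Cauchy–Schwarz applies. -/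
theorem ext0_gradient_bound (hΩ : IsOpen Ω) {u : L2 Ω} {g : L2Vec Ω} (hug : IsWeakGradient Ω u g)
    {ψ : Eucl d → ℝ} (hψ : IsTest Ω ψ) (e : Eucl d) :
    |∫ x, ext0 u x * fderiv ℝ ψ x e| ≤ ‖g‖ * ‖e‖ * (eLpNorm ψ 2 volume).toReal := by
  have h1 : ∫ x, ext0 u x * fderiv ℝ ψ x e = ∫ x in Ω, u x * fderiv ℝ ψ x e := by
    refine (setIntegral_eq_integral_of_ae ?_ fun x hx => by simp [ext0, hx]).symm
    filter_upwards [ae_restrict_mem hΩ.measurableSet] with x hx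
    rw [ext0_of_mem hx]
  rw [h1, ← inner_toLp (hψ.memLp_fderiv _ e), isWeakGradient_iff.1 hug ψ hψ e, abs_neg]
  refine (abs_real_inner_le_norm _ _).trans ?_
  rw [mul_comm, mul_assoc]
  gcongr
  rw [Lp.norm_toLp]
  have h2 : eLpNorm (fun x => ψ x • e) 2 (volume.restrict Ω) ≤
      ENNReal.ofReal ‖e‖ * eLpNorm ψ 2 volume :=
    (eLpNorm_mono_measure _ Measure.restrict_le_self).trans
      (eLpNorm_le_mul_eLpNorm_of_ae_le_mul (Eventually.of_forall fun x => by
        rw [norm_smul, mul_comm]) 2)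
  have h3 := ENNReal.toReal_mono (ENNReal.mul_ne_top ENNReal.ofReal_ne_top
    (hψ.memLp volume).eLpNorm_ne_top) h2
  rwa [ENNReal.toReal_mul, ENNReal.toReal_ofReal (norm_nonneg _)] at h3

theorem ext0_translation_estimate (hΩ : IsOpen Ω) (hb : Bornology.IsBounded Ω) {u : L2 Ω}
    {g : L2Vec Ω} (hug : IsWeakGradient Ω u g) {A : Set (Eucl d)} (hA : IsOpen A) {h : Eucl d}
    (hAh : ∀ x ∈ A, ∀ t ∈ Set.Icc (0 : ℝ) 1, x + t • h ∈ Ω) :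
    ∫⁻ x in A, ENNReal.ofReal ((ext0 u (x + h) - ext0 u x) ^ 2) ≤
      ENNReal.ofReal ((‖g‖ * ‖h‖) ^ 2) :=
  translation_estimate hA (ext0_memLp hΩ u) (ext0_integrable hΩ hb u) (norm_nonneg g)
    (fun _ hψ e => ext0_gradient_bound hΩ hug hψ e) hAh

section Constant

/-- For each h with ‖h‖ < 2r, the translation estimate gives f(x + h) = f(x) for almost every x in
the ball. By Fubini one such x serves for almost every h, and the points x + h cover the ball. The
radius 3r keeps all segments in Ω. -/
theorem ae_const_ball_of_gradient_zero (hΩ : IsOpen Ω) (hb : Bornology.IsBounded Ω) {u : L2 Ω}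
    (hu : IsWeakGradient Ω u 0) {x₀ : Eucl d} {r : ℝ} (hr : 0 < r)
    (hball : Metric.ball x₀ (3 * r) ⊆ Ω) :
    ∃ c : ℝ, ∀ᵐ y, y ∈ Metric.ball x₀ r → ext0 u y = c := by
  set f := ext0 u with hf
  have hfm : Measurable f := ext0_measurable hΩ u
  have h1 : ∀ᵐ h ∂(volume.restrict (Metric.ball (0 : Eucl d) (2 * r))),
      ∀ᵐ x ∂(volume.restrict (Metric.ball x₀ r)), f (x + h) = f x := by
    filter_upwards [ae_restrict_mem Metric.isOpen_ball.measurableSet] with h hh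
    rw [mem_ball_zero_iff] at hh
    have := ext0_translation_estimate hΩ hb hu (A := Metric.ball x₀ r) Metric.isOpen_ball (h := h)
      (fun x hx t ht => hball (by
        rw [mem_ball_iff_norm] at hx ⊢
        calc ‖x + t • h - x₀‖ = ‖(x - x₀) + t • h‖ := by congr 1; abel
          _ ≤ ‖x - x₀‖ + ‖t • h‖ := norm_add_le _ _
          _ ≤ ‖x - x₀‖ + ‖h‖ := by
            rw [norm_smul, Real.norm_of_nonneg ht.1]
            have := mul_le_mul_of_nonneg_right ht.2 (norm_nonneg h)
            linarith
          _ < 3 * r := by linarith))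
    simp only [norm_zero, zero_mul, ne_eq, OfNat.ofNat_ne_zero, not_false_eq_true, zero_pow,
      ENNReal.ofReal_zero, nonpos_iff_eq_zero] at this
    have hm : Measurable fun x => ENNReal.ofReal ((f (x + h) - f x) ^ 2) := by fun_prop
    rw [lintegral_eq_zero_iff hm] at this
    filter_upwards [this] with x hx
    have h2 : (f (x + h) - f x) ^ 2 ≤ 0 := ENNReal.ofReal_eq_zero.1 hx
    have h3 : f (x + h) - f x = 0 := by
      exact pow_eq_zero_iff (two_ne_zero) |>.1 (le_antisymm h2 (sq_nonneg _))
    linarith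
  have hms : MeasurableSet {p : Eucl d × Eucl d | f (p.2 + p.1) = f p.2} :=
    measurableSet_eq_fun (by fun_prop) (by fun_prop)
  have h2 := (Measure.ae_ae_comm hms).1 h1
  have hne : (volume.restrict (Metric.ball x₀ r)) ≠ 0 := by
    rw [Ne, Measure.restrict_eq_zero]
    exact (Metric.measure_ball_pos volume x₀ hr).ne'
  have : (ae (volume.restrict (Metric.ball x₀ r))).NeBot := ae_neBot.2 hne
  obtain ⟨x, hx, hxm⟩ := (h2.and (ae_restrict_mem Metric.isOpen_ball.measurableSet)).exists
  refine ⟨f x, ?_⟩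
  rw [ae_restrict_iff' Metric.isOpen_ball.measurableSet] at hx
  have h3 := (measurePreserving_sub_right volume x).quasiMeasurePreserving.ae hx
  filter_upwards [h3] with y hy hyb
  have := hy (by
    rw [mem_ball_zero_iff]
    rw [mem_ball_iff_norm] at hyb hxm
    calc ‖y - x‖ = ‖(y - x₀) - (x - x₀)‖ := by congr 1; abel
      _ ≤ ‖y - x₀‖ + ‖x - x₀‖ := norm_sub_le _ _
      _ < 2 * r := by linarith)
  simpa using this

/-- On a connected open set, a function with vanishing weak gradient is constant. -/
theorem eq_constL2_of_gradient_zero (hΩ : IsOpen Ω) (hc : IsPreconnected Ω)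
    (hb : Bornology.IsBounded Ω) {u : L2 Ω} (hu : IsWeakGradient Ω u 0) :
    ∃ c : ℝ, u = constL2 hb c := by
  have hloc : ∀ x : Ω, ∃ (c r : ℝ), 0 < r ∧
      ∀ᵐ y, y ∈ Metric.ball (x : Eucl d) r → ext0 u y = c := by
    intro x
    obtain ⟨r, hr, hball⟩ := Metric.isOpen_iff.1 hΩ x x.2
    obtain ⟨c, hc⟩ := ae_const_ball_of_gradient_zero hΩ hb hu (r := r / 3) (by positivity)
      (by rwa [show 3 * (r / 3) = r by ring])
    exact ⟨c, r / 3, by positivity, hc⟩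
  choose c r hr hcr using hloc
  -- Two overlapping balls meet in a nonempty open set, which has positive measure, so their
  -- constants agree.
  have hlc : IsLocallyConstant c := by
    rw [IsLocallyConstant.iff_eventually_eq]
    intro x
    have hnhds : ∀ᶠ y : Ω in 𝓝 x, (y : Eucl d) ∈ Metric.ball (x : Eucl d) (r x) :=
      continuous_subtype_val.continuousAt.eventually (Metric.ball_mem_nhds _ (hr x))
    filter_upwards [hnhds] with y hy
    have hopen : IsOpen (Metric.ball (x : Eucl d) (r x) ∩ Metric.ball (y : Eucl d) (r y)) :=
      Metric.isOpen_ball.inter Metric.isOpen_ball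
    have hpos := hopen.measure_pos volume ⟨y, hy, Metric.mem_ball_self (hr y)⟩
    have : (ae (volume.restrict (Metric.ball (x : Eucl d) (r x) ∩
        Metric.ball (y : Eucl d) (r y)))).NeBot :=
      ae_neBot.2 (by rw [Ne, Measure.restrict_eq_zero]; exact hpos.ne')
    obtain ⟨z, ⟨hz1, hz2⟩, hz⟩ := (((ae_restrict_of_ae (hcr x)).and
      (ae_restrict_of_ae (hcr y))).and (ae_restrict_mem hopen.measurableSet)).exists
    rw [← hz1 hz.1, ← hz2 hz.2]
  have : PreconnectedSpace Ω := Subtype.preconnectedSpace hc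
  obtain ⟨c0, hc0⟩ : ∃ c0, ∀ x, c x = c0 := by
    by_cases hne : Nonempty Ω
    · obtain ⟨x⟩ := hne
      exact ⟨c x, fun y => hlc.apply_eq_of_preconnectedSpace y x⟩
    · exact ⟨0, fun x => (hne ⟨x⟩).elim⟩
  refine ⟨c0, Lp.ext ?_⟩
  refine EventuallyEq.trans ?_ (constL2_ae hb c0).symm
  rw [EventuallyEq, ae_restrict_iff' hΩ.measurableSet, ae_iff]
  refine measure_null_of_locally_null _ fun x hx => ?_
  have hxΩ : x ∈ Ω := by
    by_contra hcon
    exact hx fun h => (hcon h).elim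
  refine ⟨Metric.ball x (r ⟨x, hxΩ⟩) ∩ {a | ¬ (a ∈ Ω → u a = c0)}, ?_, ?_⟩
  · exact inter_mem (mem_nhdsWithin_of_mem_nhds (Metric.ball_mem_nhds _ (hr ⟨x, hxΩ⟩)))
      self_mem_nhdsWithin
  · have h1 := hcr ⟨x, hxΩ⟩
    rw [ae_iff] at h1
    refine measure_mono_null (fun y hy => ?_) h1
    intro h2
    refine hy.2 fun hyΩ => ?_
    rw [← ext0_of_mem hyΩ, h2 hy.1, hc0]

end Constant

section Strip

theorem setLIntegral_biUnion_le {α ι : Type*} [MeasurableSpace α] {μ : Measure α} (t : Finset ι)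
    (A : ι → Set α) (f : α → ENNReal) :
    ∫⁻ x in ⋃ i ∈ t, A i, f x ∂μ ≤ ∑ i ∈ t, ∫⁻ x in A i, f x ∂μ := by
  classical
  induction t using Finset.induction_on with
  | empty => simp
  | insert i t hi ih =>
    rw [Finset.set_biUnion_insert, Finset.sum_insert hi]
    exact (lintegral_union_le _ _ _).trans (by gcongr)

/-- `ρ` is the height above the graph along `ν`, so it grows at unit speed in that direction. A
shift by at most r/4 from the ball of radius r/2 stays in the ball of radius r where the graph
describes Ω. -/
theorem IsLipschitzDomain.exists_chart (hΩ : IsLipschitzDomain Ω) {x : Eucl d}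
    (hx : x ∈ frontier Ω) : ∃ (U : Set (Eucl d)) (ν : Eucl d) (ρ : Eucl d → ℝ) (s : ℝ),
      IsOpen U ∧ x ∈ U ∧ ‖ν‖ = 1 ∧ Continuous ρ ∧ 0 < s ∧
      (∀ (y : Eucl d) (t : ℝ), ρ (y + t • ν) = ρ y + t) ∧ (∀ y ∈ U, y ∈ Ω ↔ 0 < ρ y) ∧
      ∀ y ∈ U, y ∈ Ω → ∀ t ∈ Set.Icc 0 s, y + t • ν ∈ Ω := by
  obtain ⟨ν, γ, L, r, hν, hγ, hr, h⟩ := hΩ.boundary x hx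
  have hshift : ∀ (y : Eucl d) (t : ℝ), inner ℝ ν (y + t • ν) = inner ℝ ν y + t := fun y t => by
    rw [inner_add_right, inner_smul_right, real_inner_self_eq_norm_sq, hν]
    ring
  have hγc := hγ.continuous
  have hρ : ∀ (y : Eucl d) (t : ℝ), inner ℝ ν (y + t • ν) -
      γ (y + t • ν - (inner ℝ ν (y + t • ν) : ℝ) • ν) =
      inner ℝ ν y - γ (y - (inner ℝ ν y : ℝ) • ν) + t := fun y t => by
    have h1 : y + t • ν - (inner ℝ ν (y + t • ν) : ℝ) • ν = y - (inner ℝ ν y : ℝ) • ν := by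
      rw [hshift, add_smul]
      abel
    rw [h1, hshift]
    ring
  refine ⟨Metric.ball x (r / 2), ν, fun y => inner ℝ ν y - γ (y - (inner ℝ ν y : ℝ) • ν), r / 4,
    Metric.isOpen_ball, Metric.mem_ball_self (by positivity), hν, by fun_prop, by positivity, hρ,
    fun y hy => ?_, fun y hy hyΩ t ht => ?_⟩
  · rw [h y (Metric.ball_subset_ball (by linarith) hy), sub_pos]
  · have h1 := (h y (Metric.ball_subset_ball (by linarith) hy)).1 hyΩ
    refine (h _ ?_).2 ?_
    · rw [mem_ball_iff_norm] at hy ⊢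
      calc ‖y + t • ν - x‖ = ‖(y - x) + t • ν‖ := by congr 1; abel
        _ ≤ ‖y - x‖ + ‖t • ν‖ := norm_add_le _ _
        _ < r := by
          rw [norm_smul, hν, Real.norm_of_nonneg ht.1]
          have := ht.2
          linarith
    · have h2 := hρ y t
      have h3 := ht.1
      linarith

/-- The two sides differ by (2a − b)². -/
theorem ofReal_sq_le (a b : ℝ) : ENNReal.ofReal (b ^ 2) ≤
    ENNReal.ofReal 2 * ENNReal.ofReal (a ^ 2) + ENNReal.ofReal 2 * ENNReal.ofReal ((a - b) ^ 2) := by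
  rw [← ENNReal.ofReal_mul (by norm_num), ← ENNReal.ofReal_mul (by norm_num),
    ← ENNReal.ofReal_add (by positivity) (by positivity)]
  exact ENNReal.ofReal_le_ofReal (by nlinarith [sq_nonneg (2 * a - b)])

/-- The mass of an `H¹` function in a thin boundary strip is uniformly small. -/
theorem exists_strip_estimate (hΩ : IsOpen Ω) (hb : Bornology.IsBounded Ω) {U : Set (Eucl d)}
    (hU : IsOpen U) {ν : Eucl d} (hν : ‖ν‖ = 1) {ρ : Eucl d → ℝ} (hρ : Continuous ρ) {s : ℝ}
    (hs : 0 < s) (hshift : ∀ (y : Eucl d) (t : ℝ), ρ (y + t • ν) = ρ y + t)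
    (hUΩ : ∀ y ∈ U, y ∈ Ω ↔ 0 < ρ y) (hseg : ∀ y ∈ U, y ∈ Ω → ∀ t ∈ Set.Icc 0 s, y + t • ν ∈ Ω)
    {C : ℝ} (hC : 0 ≤ C) {ε : ℝ} (hε : 0 < ε) :
    ∃ δ > 0, ∀ (u : L2 Ω) (g : L2Vec Ω), IsWeakGradient Ω u g → ‖u‖ ≤ C → ‖g‖ ≤ C →
      ∫⁻ x in {y | y ∈ U ∧ y ∈ Ω ∧ ρ y < δ}, ENNReal.ofReal (ext0 u x ^ 2) ≤
        ENNReal.ofReal ε := by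
  -- The strip `S` of height δ = η/N has N disjoint translates by jδν, 1 ≤ j ≤ N, of total mass at
  -- most C². Each has at least half the mass of `S` up to a translation error, so N·mass(S) ≤ 2C² +
  -- Nε/2. This choice of N makes 2C² ≤ Nε/2.
  obtain ⟨N, hN⟩ := exists_nat_gt (4 * C ^ 2 / ε)
  have hN0 : (0 : ℝ) < N := lt_of_le_of_lt (by positivity) hN
  have hNC : 2 * C ^ 2 ≤ N * (ε / 2) := by
    rw [div_lt_iff₀ hε] at hN
    linarith
  obtain ⟨η, hη, hηs, hηC⟩ : ∃ η > 0, η ≤ s ∧ 2 * (C * η) ^ 2 ≤ ε / 2 := by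
    have hlim : Tendsto (fun η : ℝ => 2 * (C * η) ^ 2) (𝓝[>] 0) (𝓝 0) := by
      have : Continuous (fun η : ℝ => 2 * (C * η) ^ 2) := by fun_prop
      simpa using (this.tendsto 0).mono_left nhdsWithin_le_nhds
    have h1 := hlim.eventually (ge_mem_nhds (half_pos hε))
    have h2 : ∀ᶠ η : ℝ in 𝓝[>] 0, η ≤ s := nhdsWithin_le_nhds (ge_mem_nhds hs)
    have h3 : ∀ᶠ η : ℝ in 𝓝[>] 0, 0 < η := self_mem_nhdsWithin
    obtain ⟨η, ⟨hη1, hη2⟩, hη3⟩ := ((h1.and h2).and h3).exists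
    exact ⟨η, hη3, hη2, hη1⟩
  set δ := η / N with hδdef
  have hδ : 0 < δ := div_pos hη hN0
  have hNδ : N * δ = η := by rw [hδdef]; field_simp
  refine ⟨δ, hδ, fun u g hug hu hg => ?_⟩
  set f := ext0 u
  have hfm : Measurable f := ext0_measurable hΩ u
  set S : Set (Eucl d) := {y | y ∈ U ∧ y ∈ Ω ∧ ρ y < δ} with hS
  have hSo : IsOpen S := hU.inter (hΩ.inter (isOpen_lt hρ continuous_const))
  have hstep : ∀ j ∈ Finset.Icc 1 N, ∫⁻ x in S, ENNReal.ofReal (f x ^ 2) ≤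
      ENNReal.ofReal 2 * (∫⁻ x in {y | y - ((j : ℝ) * δ) • ν ∈ S}, ENNReal.ofReal (f x ^ 2)) +
        ENNReal.ofReal (ε / 2) := by
    intro j hj
    rw [Finset.mem_Icc] at hj
    have hjN : (j : ℝ) * δ ≤ η := by
      rw [← hNδ]
      gcongr
      exact hj.2
    have hj0 : 0 ≤ (j : ℝ) * δ := by positivity
    have htr := ext0_translation_estimate hΩ hb hug hSo (h := ((j : ℝ) * δ) • ν)
      (fun x hx t ht => by
        rw [smul_smul]
        refine hseg x hx.1 hx.2.1 _ ⟨mul_nonneg ht.1 hj0, ?_⟩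
        calc t * (j * δ) ≤ 1 * (j * δ) := mul_le_mul_of_nonneg_right ht.2 hj0
          _ ≤ s := by linarith)
    have hmp := (measurePreserving_add_right volume (((j : ℝ) * δ) • ν)).setLIntegral_comp_preimage
      (s := {y : Eucl d | y - ((j : ℝ) * δ) • ν ∈ S})
      (f := fun x => ENNReal.ofReal (f x ^ 2))
      (hSo.measurableSet.preimage (by fun_prop)) (by fun_prop)
    have hpre : (fun x => x + ((j : ℝ) * δ) • ν) ⁻¹' {y : Eucl d | y - ((j : ℝ) * δ) • ν ∈ S} = S := by
      ext y
      simp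
    rw [hpre] at hmp
    calc ∫⁻ x in S, ENNReal.ofReal (f x ^ 2)
        ≤ ∫⁻ x in S, (ENNReal.ofReal 2 * ENNReal.ofReal (f (x + ((j : ℝ) * δ) • ν) ^ 2) +
          ENNReal.ofReal 2 * ENNReal.ofReal ((f (x + ((j : ℝ) * δ) • ν) - f x) ^ 2)) :=
          lintegral_mono fun x => ofReal_sq_le _ _
      _ = ENNReal.ofReal 2 * (∫⁻ x in S, ENNReal.ofReal (f (x + ((j : ℝ) * δ) • ν) ^ 2)) +
          ENNReal.ofReal 2 *
            ∫⁻ x in S, ENNReal.ofReal ((f (x + ((j : ℝ) * δ) • ν) - f x) ^ 2) := by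
          rw [lintegral_add_left (by fun_prop), lintegral_const_mul _ (by fun_prop),
            lintegral_const_mul _ (by fun_prop)]
      _ ≤ _ := by
          rw [hmp]
          gcongr
          calc _ ≤ ENNReal.ofReal 2 * ENNReal.ofReal ((‖g‖ * ‖((j : ℝ) * δ) • ν‖) ^ 2) := by
                gcongr
            _ ≤ ENNReal.ofReal (ε / 2) := by
                rw [← ENNReal.ofReal_mul (by norm_num)]
                refine ENNReal.ofReal_le_ofReal (le_trans ?_ hηC)
                rw [norm_smul, hν, mul_one, Real.norm_of_nonneg hj0]
                gcongr
  have hsum := Finset.sum_le_sum hstep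
  rw [Finset.sum_const, Nat.card_Icc, Nat.add_sub_cancel, Finset.sum_add_distrib, ← Finset.mul_sum,
    Finset.sum_const, Nat.card_Icc, Nat.add_sub_cancel, nsmul_eq_mul, nsmul_eq_mul,
    ← lintegral_biUnion_finset] at hsum
  · have htot : ∫⁻ x in ⋃ j ∈ Finset.Icc 1 N, {y | y - ((j : ℝ) * δ) • ν ∈ S},
        ENNReal.ofReal (f x ^ 2) ≤ ENNReal.ofReal (C ^ 2) := by
      refine (setLIntegral_le_lintegral _ _).trans ?_
      rw [lintegral_ext0_sq hΩ]
      exact ENNReal.ofReal_le_ofReal (by gcongr)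
    have hfinal : (N : ENNReal) * ∫⁻ x in S, ENNReal.ofReal (f x ^ 2) ≤ N * ENNReal.ofReal ε := by
      refine hsum.trans ?_
      calc _ ≤ ENNReal.ofReal 2 * ENNReal.ofReal (C ^ 2) + N * ENNReal.ofReal (ε / 2) := by gcongr
        _ = ENNReal.ofReal (2 * C ^ 2 + N * (ε / 2)) := by
          rw [← ENNReal.ofReal_mul (by norm_num), ← ENNReal.ofReal_natCast,
            ← ENNReal.ofReal_mul (by positivity), ENNReal.ofReal_add (by positivity) (by positivity)]
        _ ≤ ENNReal.ofReal (N * ε) := ENNReal.ofReal_le_ofReal (by linarith)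
        _ = _ := by rw [ENNReal.ofReal_mul (by positivity), ENNReal.ofReal_natCast]
    have hNne : (N : ENNReal) ≠ 0 := by
      have : N ≠ 0 := by rintro rfl; simp at hN0
      exact_mod_cast this
    exact (ENNReal.mul_le_mul_iff_right hNne (ENNReal.natCast_ne_top N)).1 hfinal
  · intro i _ j _ hij
    refine Set.disjoint_left.2 fun y hyi hyj => hij ?_
    -- On `S` the height lies strictly between 0 and δ, so the translates occupy disjoint height
    -- ranges.
    have key : ∀ k : ℕ, y - ((k : ℝ) * δ) • ν ∈ S → (k : ℝ) * δ < ρ y ∧ ρ y < (k + 1) * δ := by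
      intro k hk
      have h1 := hshift (y - ((k : ℝ) * δ) • ν) ((k : ℝ) * δ)
      rw [sub_add_cancel] at h1
      have h2 := (hUΩ _ hk.1).1 hk.2.1
      have h3 := hk.2.2
      constructor <;> linarith
    have hi := key i hyi
    have hj := key j hyj
    have h1 : (i : ℝ) < j + 1 := lt_of_mul_lt_mul_right (hi.1.trans hj.2) hδ.le
    have h2 : (j : ℝ) < i + 1 := lt_of_mul_lt_mul_right (hj.1.trans hi.2) hδ.le
    have h1' : i < j + 1 := by exact_mod_cast h1
    have h2' : j < i + 1 := by exact_mod_cast h2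
    omega
  · intro j _
    exact hSo.measurableSet.preimage (by fun_prop)

/-- The mass of an `H¹` function near the boundary is uniformly small. -/
theorem exists_compact_tail_estimate (hΩ : IsLipschitzDomain Ω) (hb : Bornology.IsBounded Ω)
    {C : ℝ} (hC : 0 ≤ C) {ε : ℝ} (hε : 0 < ε) :
    ∃ K : Set (Eucl d), IsCompact K ∧ K ⊆ Ω ∧
      ∀ (u : L2 Ω) (g : L2Vec Ω), IsWeakGradient Ω u g → ‖u‖ ≤ C → ‖g‖ ≤ C →
        ∫⁻ x in Ω \ K, ENNReal.ofReal (ext0 u x ^ 2) ≤ ENNReal.ofReal ε := by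
  have hfc : IsCompact (frontier Ω) := by
    refine Metric.isCompact_of_isClosed_isBounded isClosed_frontier ?_
    exact hb.closure.subset frontier_subset_closure
  choose! U ν ρ s hU hxU hν hρ hs hshift hUΩ hseg using fun x (hx : x ∈ frontier Ω) =>
    hΩ.exists_chart hx
  obtain ⟨t, ht, hcov⟩ := hfc.elim_nhds_subcover U
    (fun x hx => (hU x hx).mem_nhds (hxU x hx))
  -- The summand 1 avoids division by zero when the cover is empty.
  have hcard : (0 : ℝ) < t.card + 1 := by positivity
  have hstrip : ∀ x ∈ frontier Ω, ∃ δ > 0, ∀ (u : L2 Ω) (g : L2Vec Ω), IsWeakGradient Ω u g →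
      ‖u‖ ≤ C → ‖g‖ ≤ C →
      ∫⁻ z in {y | y ∈ U x ∧ y ∈ Ω ∧ ρ x y < δ}, ENNReal.ofReal (ext0 u z ^ 2) ≤
        ENNReal.ofReal (ε / (t.card + 1)) := fun x hx =>
    exists_strip_estimate hΩ.isOpen hb (hU x hx) (hν x hx) (hρ x hx) (hs x hx) (hshift x hx)
      (hUΩ x hx) (hseg x hx) hC (div_pos hε hcard)
  choose! δ hδ hest using hstrip
  -- The removed sets also contain the chart points with ρ ≤ 0, hence the whole frontier; so `K`
  -- lies in Ω.
  refine ⟨closure Ω \ ⋃ x ∈ t, {y | y ∈ U x ∧ ρ x y < δ x}, ?_, ?_, fun u g hug hu hg => ?_⟩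
  · refine hb.isCompact_closure.diff (isOpen_biUnion fun x hx => ?_)
    exact (hU x (ht x hx)).inter (isOpen_lt (hρ x (ht x hx)) continuous_const)
  · intro y hy
    by_contra hyΩ
    have hyf : y ∈ frontier Ω := by
      rw [frontier, hΩ.isOpen.interior_eq]
      exact ⟨hy.1, hyΩ⟩
    obtain ⟨x, hx, hyx⟩ := Set.mem_iUnion₂.1 (hcov hyf)
    refine hy.2 (Set.mem_iUnion₂.2 ⟨x, hx, hyx, ?_⟩)
    have h1 : ¬ 0 < ρ x y := fun h => hyΩ ((hUΩ x (ht x hx) y hyx).2 h)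
    exact lt_of_le_of_lt (not_lt.1 h1) (hδ x (ht x hx))
  · have hsub : Ω \ (closure Ω \ ⋃ x ∈ t, {y | y ∈ U x ∧ ρ x y < δ x}) ⊆
        ⋃ x ∈ t, {y | y ∈ U x ∧ y ∈ Ω ∧ ρ x y < δ x} := by
      rintro y ⟨hyΩ, hy⟩
      have : y ∈ ⋃ x ∈ t, {y | y ∈ U x ∧ ρ x y < δ x} := by
        by_contra hcon
        exact hy ⟨subset_closure hyΩ, hcon⟩
      obtain ⟨x, hx, h1, h2⟩ := Set.mem_iUnion₂.1 this
      exact Set.mem_iUnion₂.2 ⟨x, hx, h1, hyΩ, h2⟩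
    calc _ ≤ ∫⁻ z in ⋃ x ∈ t, {y | y ∈ U x ∧ y ∈ Ω ∧ ρ x y < δ x}, ENNReal.ofReal (ext0 u z ^ 2) :=
          lintegral_mono_set hsub
      _ ≤ ∑ x ∈ t, ∫⁻ z in {y | y ∈ U x ∧ y ∈ Ω ∧ ρ x y < δ x}, ENNReal.ofReal (ext0 u z ^ 2) :=
          setLIntegral_biUnion_le t _ _
      _ ≤ ∑ x ∈ t, ENNReal.ofReal (ε / (t.card + 1)) :=
          Finset.sum_le_sum fun x hx => hest x (ht x hx) u g hug hu hg
      _ = ENNReal.ofReal (t.card * (ε / (t.card + 1))) := by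
          rw [Finset.sum_const, nsmul_eq_mul, ENNReal.ofReal_mul (by positivity),
            ENNReal.ofReal_natCast]
      _ ≤ ENNReal.ofReal ε := by
          refine ENNReal.ofReal_le_ofReal ?_
          rw [mul_div_assoc', div_le_iff₀ hcard]
          nlinarith

end Strip

end

/-! ### Ball averages and the Rellich theorem. -/

section

variable {d : ℕ} {Ω : Set (Eucl d)}

/-- Jensen's inequality for the square. -/
theorem ofReal_sub_integral_sq_le {α : Type*} [MeasurableSpace α] {P : Measure α}
    [IsProbabilityMeasure P] {φ : α → ℝ} (hφ : MemLp φ 2 P) (c : ℝ) :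
    ENNReal.ofReal ((c - ∫ x, φ x ∂P) ^ 2) ≤ ∫⁻ x, ENNReal.ofReal ((φ x - c) ^ 2) ∂P := by
  have hφc : MemLp (fun x => φ x - c) 2 P := hφ.sub (memLp_const c)
  have hi : Integrable φ P := hφ.integrable (by norm_num)
  have h1 : ∫ x, (φ x - c) ∂P = (∫ x, φ x ∂P) - c := by
    rw [integral_sub hi (integrable_const c)]
    simp
  have h2 : (∫ x, (φ x - c) ∂P) ^ 2 ≤ ∫ x, (φ x - c) ^ 2 ∂P :=
    (even_two.convexOn_pow (𝕜 := ℝ)).map_integral_le (continuous_pow 2).continuousOn isClosed_univ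
      (Eventually.of_forall fun _ => Set.mem_univ _) (hφc.integrable (by norm_num))
      hφc.integrable_sq
  rw [← ofReal_integral_eq_lintegral_ofReal hφc.integrable_sq
    (Eventually.of_forall fun _ => sq_nonneg _)]
  refine ENNReal.ofReal_le_ofReal (le_trans (le_of_eq ?_) h2)
  rw [h1]
  ring

/-- The uniform probability measure on the ball of radius `η` centred at `0`. -/
def ballMeasure (d : ℕ) (η : ℝ) : Measure (Eucl d) :=
  (volume (Metric.ball (0 : Eucl d) η))⁻¹ • volume.restrict (Metric.ball 0 η)

section

variable {η : ℝ}

theorem isProbabilityMeasure_ballMeasure (hη : 0 < η) : IsProbabilityMeasure (ballMeasure d η) := by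
  refine ⟨?_⟩
  rw [ballMeasure, Measure.smul_apply, Measure.restrict_apply_univ, smul_eq_mul]
  exact ENNReal.inv_mul_cancel (Metric.measure_ball_pos volume 0 hη).ne' measure_ball_lt_top.ne

theorem memLp_translate_ballMeasure (hη : 0 < η) {f : Eucl d → ℝ} (hf : MemLp f 2 volume)
    (x : Eucl d) : MemLp (fun h => f (x + h)) 2 (ballMeasure d η) := by
  have h1 : MemLp (fun h => f (x + h)) 2 volume :=
    hf.comp_measurePreserving (measurePreserving_add_left volume x)
  exact (h1.mono_measure Measure.restrict_le_self).smul_measure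
    (ENNReal.inv_ne_top.2 (Metric.measure_ball_pos volume 0 hη).ne')

theorem ae_ballMeasure_mem_ball : ∀ᵐ h ∂(ballMeasure d η), h ∈ Metric.ball (0 : Eucl d) η :=
  Measure.ae_smul_measure (ae_restrict_mem Metric.isOpen_ball.measurableSet) _

variable (η) in
/-- The average of `f` over the ball of radius `η`. -/
def ballAvg (f : Eucl d → ℝ) (x : Eucl d) : ℝ := ∫ h, f (x + h) ∂(ballMeasure d η)

theorem measurable_ballAvg (hη : 0 < η) {f : Eucl d → ℝ} (hf : Measurable f) :
    Measurable (ballAvg η f) := by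
  have := isProbabilityMeasure_ballMeasure (d := d) hη
  have h1 : StronglyMeasurable (fun p : Eucl d × Eucl d => f (p.1 + p.2)) :=
    (hf.comp (by fun_prop)).stronglyMeasurable
  exact h1.integral_prod_right'.measurable

/-- Jensen, Tonelli and the translation estimate. `K` is replaced by its open η-thickening because
that estimate is for open sets; shifting by less than η more stays within δ of `K`. -/
theorem lintegral_sub_ballAvg_le (hΩ : IsOpen Ω) (hb : Bornology.IsBounded Ω) {u : L2 Ω}
    {g : L2Vec Ω} (hug : IsWeakGradient Ω u g) {K : Set (Eucl d)} {δ : ℝ}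
    (hK : Metric.thickening δ K ⊆ Ω) (hη : 0 < η) (hηδ : 2 * η ≤ δ) :
    ∫⁻ x in K, ENNReal.ofReal ((ext0 u x - ballAvg η (ext0 u) x) ^ 2) ≤
      ENNReal.ofReal ((‖g‖ * η) ^ 2) := by
  have := isProbabilityMeasure_ballMeasure (d := d) hη
  have hfm := ext0_measurable hΩ u
  calc _ ≤ ∫⁻ x in Metric.thickening η K,
        ENNReal.ofReal ((ext0 u x - ballAvg η (ext0 u) x) ^ 2) :=
        lintegral_mono_set (Metric.self_subset_thickening hη K)
    _ ≤ ∫⁻ x in Metric.thickening η K, (∫⁻ h, ENNReal.ofReal ((ext0 u (x + h) - ext0 u x) ^ 2)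
          ∂(ballMeasure d η)) :=
        lintegral_mono fun x =>
          ofReal_sub_integral_sq_le (memLp_translate_ballMeasure hη (ext0_memLp hΩ u) x) _
    _ = ∫⁻ h, (∫⁻ x in Metric.thickening η K, ENNReal.ofReal ((ext0 u (x + h) - ext0 u x) ^ 2))
          ∂(ballMeasure d η) := lintegral_lintegral_swap (by
            have : Measurable (Function.uncurry fun (x h : Eucl d) =>
              ENNReal.ofReal ((ext0 u (x + h) - ext0 u x) ^ 2)) := by
              unfold Function.uncurry
              fun_prop
            exact this.aemeasurable)
    _ ≤ ∫⁻ _, ENNReal.ofReal ((‖g‖ * η) ^ 2) ∂(ballMeasure d η) := by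
        refine lintegral_mono_ae ?_
        filter_upwards [ae_ballMeasure_mem_ball] with h hh
        rw [mem_ball_zero_iff] at hh
        refine (ext0_translation_estimate hΩ hb hug Metric.isOpen_thickening
          fun x hx t ht => hK ?_).trans (ENNReal.ofReal_le_ofReal (by gcongr))
        obtain ⟨z, hz, hxz⟩ := Metric.mem_thickening_iff.1 hx
        refine Metric.mem_thickening_iff.2 ⟨z, hz, ?_⟩
        rw [dist_eq_norm] at hxz ⊢
        calc ‖x + t • h - z‖ = ‖(x - z) + t • h‖ := by congr 1; abel
          _ ≤ ‖x - z‖ + ‖t • h‖ := norm_add_le _ _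
          _ ≤ ‖x - z‖ + ‖h‖ := by
            rw [norm_smul, Real.norm_of_nonneg ht.1]
            have := mul_le_mul_of_nonneg_right ht.2 (norm_nonneg h)
            linarith
          _ < δ := by linarith
    _ = _ := by simp

theorem ofReal_ballAvg_sq_le (hΩ : IsOpen Ω) (u : L2 Ω) (hη : 0 < η) (x : Eucl d) :
    ENNReal.ofReal (ballAvg η (ext0 u) x ^ 2) ≤
      (volume (Metric.ball (0 : Eucl d) η))⁻¹ * ENNReal.ofReal (‖u‖ ^ 2) := by
  have := isProbabilityMeasure_ballMeasure (d := d) hη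
  have h1 := ofReal_sub_integral_sq_le (memLp_translate_ballMeasure hη (ext0_memLp hΩ u) x) 0
  simp only [zero_sub, neg_sq, sub_zero] at h1
  refine h1.trans ?_
  rw [ballMeasure, lintegral_smul_measure, smul_eq_mul, ← lintegral_ext0_sq hΩ u,
    ← lintegral_add_left_eq_self (fun y => ENNReal.ofReal (ext0 u y ^ 2)) x]
  gcongr
  exact Measure.restrict_le_self

/-- Each average is a multiple of an inner product with the indicator of a ball, so weak convergence
gives pointwise convergence. -/
theorem tendsto_ballAvg (hΩ : IsOpen Ω) {u : ℕ → L2 Ω}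
    (hu : ∀ z, Tendsto (fun n => inner ℝ (u n) z) atTop (𝓝 0)) (x : Eucl d) :
    Tendsto (fun n => ballAvg η (ext0 (u n)) x) atTop (𝓝 0) := by
  have hmem : MemLp ((Metric.ball x η).indicator fun _ => (1 : ℝ)) 2 (volume.restrict Ω) :=
    memLp_indicator_const 2 Metric.isOpen_ball.measurableSet 1
      (Or.inr (ne_top_of_le_ne_top measure_ball_lt_top.ne (Measure.restrict_apply_le _ _)))
  have key : ∀ n, ballAvg η (ext0 (u n)) x =
      (volume (Metric.ball (0 : Eucl d) η))⁻¹.toReal * inner ℝ (u n) (hmem.toLp _) := fun n => by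
    rw [ballAvg, ballMeasure, integral_smul_measure, smul_eq_mul, real_inner_comm, inner_toLp]
    congr 1
    rw [← integral_indicator Metric.isOpen_ball.measurableSet, ← integral_indicator hΩ.measurableSet,
      ← integral_add_left_eq_self (Ω.indicator _) x]
    congr 1
    ext h
    have h1 : x + h ∈ Metric.ball x η ↔ h ∈ Metric.ball 0 η := by simp
    by_cases hb : h ∈ Metric.ball 0 η <;> by_cases ho : x + h ∈ Ω <;>
      simp [Set.indicator, hb, ho, h1, ext0]
  simp_rw [key]
  simpa using (hu (hmem.toLp _)).const_mul _

end

/-- Split the function into its ball average and the remainder. The remainder is at most Cη in L²(K)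
uniformly in n; for fixed η the averages tend to 0 by dominated convergence. -/
theorem tendsto_lintegral_compact (hΩ : IsOpen Ω) (hb : Bornology.IsBounded Ω) {C : ℝ}
    {u : ℕ → L2 Ω} {g : ℕ → L2Vec Ω} (hug : ∀ n, IsWeakGradient Ω (u n) (g n))
    (hu : ∀ n, ‖u n‖ ≤ C) (hg : ∀ n, ‖g n‖ ≤ C)
    (hweak : ∀ z, Tendsto (fun n => inner ℝ (u n) z) atTop (𝓝 0)) {K : Set (Eucl d)}
    (hK : IsCompact K) (hKΩ : K ⊆ Ω) {ε : ℝ} (hε : 0 < ε) :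
    ∀ᶠ n in atTop, ∫⁻ x in K, ENNReal.ofReal (ext0 (u n) x ^ 2) ≤ ENNReal.ofReal ε := by
  obtain ⟨δ, hδ, hδK⟩ := hK.exists_thickening_subset_open hΩ hKΩ
  obtain ⟨η, hη, hηδ, hηC⟩ : ∃ η > 0, 2 * η ≤ δ ∧ 2 * (C * η) ^ 2 ≤ ε / 2 := by
    have hlim : Tendsto (fun η : ℝ => 2 * (C * η) ^ 2) (𝓝[>] 0) (𝓝 0) := by
      have : Continuous (fun η : ℝ => 2 * (C * η) ^ 2) := by fun_prop
      simpa using (this.tendsto 0).mono_left nhdsWithin_le_nhds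
    have h1 := hlim.eventually (ge_mem_nhds (half_pos hε))
    have h2 : ∀ᶠ η : ℝ in 𝓝[>] 0, η ≤ δ / 2 := nhdsWithin_le_nhds (ge_mem_nhds (half_pos hδ))
    have h3 : ∀ᶠ η : ℝ in 𝓝[>] 0, 0 < η := self_mem_nhdsWithin
    obtain ⟨η, ⟨hη1, hη2⟩, hη3⟩ := ((h1.and h2).and h3).exists
    exact ⟨η, hη3, by linarith, hη1⟩
  have hball := (Metric.measure_ball_pos volume (0 : Eucl d) hη).ne'
  have hDCT : Tendsto (fun n => ∫⁻ x in K, ENNReal.ofReal (ballAvg η (ext0 (u n)) x ^ 2)) atTop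
      (𝓝 (∫⁻ x in K, (0 : ENNReal))) := by
    refine tendsto_lintegral_of_dominated_convergence
      (fun _ => (volume (Metric.ball (0 : Eucl d) η))⁻¹ * ENNReal.ofReal (C ^ 2)) (fun n => ?_)
      (fun n => Eventually.of_forall fun x => ?_) ?_ (Eventually.of_forall fun x => ?_)
    · have := measurable_ballAvg hη (ext0_measurable hΩ (u n))
      fun_prop
    · refine (ofReal_ballAvg_sq_le hΩ (u n) hη x).trans ?_
      change _ ≤ (volume (Metric.ball (0 : Eucl d) η))⁻¹ * ENNReal.ofReal (C ^ 2)
      gcongr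
      exact hu n
    · rw [lintegral_const, Measure.restrict_apply_univ]
      exact ENNReal.mul_ne_top (ENNReal.mul_ne_top (ENNReal.inv_ne_top.2 hball)
        ENNReal.ofReal_ne_top) hK.measure_lt_top.ne
    · have h1 := ((tendsto_ballAvg (η := η) hΩ hweak x).pow 2)
      have h2 := (ENNReal.continuous_ofReal.tendsto _).comp h1
      simp only [ne_eq, OfNat.ofNat_ne_zero, not_false_eq_true, zero_pow,
        ENNReal.ofReal_zero] at h2
      exact h2
  rw [lintegral_zero] at hDCT
  have hev := hDCT.eventually (ge_mem_nhds (ENNReal.ofReal_pos.2 (show 0 < ε / 4 by positivity)))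
  filter_upwards [hev] with n hn
  have hm := measurable_ballAvg hη (ext0_measurable hΩ (u n))
  have hm' := ext0_measurable hΩ (u n)
  calc ∫⁻ x in K, ENNReal.ofReal (ext0 (u n) x ^ 2)
      ≤ ∫⁻ x in K, (ENNReal.ofReal 2 * ENNReal.ofReal (ballAvg η (ext0 (u n)) x ^ 2) +
          ENNReal.ofReal 2 *
            ENNReal.ofReal ((ext0 (u n) x - ballAvg η (ext0 (u n)) x) ^ 2)) := by
        refine lintegral_mono fun x => (ofReal_sq_le (ballAvg η (ext0 (u n)) x) _).trans ?_
        rw [sub_sq_comm]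
    _ = ENNReal.ofReal 2 * (∫⁻ x in K, ENNReal.ofReal (ballAvg η (ext0 (u n)) x ^ 2)) +
          ENNReal.ofReal 2 *
            ∫⁻ x in K, ENNReal.ofReal ((ext0 (u n) x - ballAvg η (ext0 (u n)) x) ^ 2) := by
        rw [lintegral_add_left (by fun_prop), lintegral_const_mul _ (by fun_prop),
          lintegral_const_mul _ (by fun_prop)]
    _ ≤ ENNReal.ofReal 2 * ENNReal.ofReal (ε / 4) +
          ENNReal.ofReal 2 * ENNReal.ofReal ((C * η) ^ 2) := by
        gcongr
        refine (lintegral_sub_ballAvg_le hΩ hb (hug n) hδK hη hηδ).trans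
          (ENNReal.ofReal_le_ofReal ?_)
        gcongr
        exact hg n
    _ ≤ ENNReal.ofReal ε := by
        rw [← ENNReal.ofReal_mul (by norm_num), ← ENNReal.ofReal_mul (by norm_num),
          ← ENNReal.ofReal_add (by positivity) (by positivity)]
        exact ENNReal.ofReal_le_ofReal (by linarith)

/-- The **Rellich compactness theorem** on a bounded Lipschitz domain. -/
theorem rellich (hΩ : IsLipschitzDomain Ω) (hb : Bornology.IsBounded Ω) {C : ℝ}
    {u : ℕ → L2 Ω} {g : ℕ → L2Vec Ω} (hug : ∀ n, IsWeakGradient Ω (u n) (g n))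
    (hu : ∀ n, ‖u n‖ ≤ C) (hg : ∀ n, ‖g n‖ ≤ C)
    (hweak : ∀ z, Tendsto (fun n => inner ℝ (u n) z) atTop (𝓝 0)) :
    Tendsto u atTop (𝓝 0) := by
  have hC : 0 ≤ C := (norm_nonneg _).trans (hu 0)
  rw [Metric.tendsto_atTop]
  intro ε hε
  obtain ⟨K, hK, hKΩ, htail⟩ := exists_compact_tail_estimate hΩ hb hC
    (ε := ε ^ 2 / 4) (by positivity)
  obtain ⟨N, hN⟩ := eventually_atTop.1 (tendsto_lintegral_compact hΩ.isOpen hb hug hu hg hweak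
    hK hKΩ (ε := ε ^ 2 / 4) (by positivity))
  refine ⟨N, fun n hn => ?_⟩
  have h1 : ENNReal.ofReal (‖u n‖ ^ 2) ≤ ENNReal.ofReal (ε ^ 2 / 2) := by
    rw [← lintegral_ofReal_coe_sq]
    calc ∫⁻ x in Ω, ENNReal.ofReal (u n x ^ 2) = ∫⁻ x in Ω, ENNReal.ofReal (ext0 (u n) x ^ 2) :=
          setLIntegral_congr_fun hΩ.isOpen.measurableSet fun x hx => by rw [ext0_of_mem hx]
      _ ≤ ∫⁻ x in K ∪ Ω \ K, ENNReal.ofReal (ext0 (u n) x ^ 2) :=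
          lintegral_mono_set (by rw [Set.union_sdiff_self]; exact Set.subset_union_right)
      _ ≤ _ := lintegral_union_le _ _ _
      _ ≤ ENNReal.ofReal (ε ^ 2 / 4) + ENNReal.ofReal (ε ^ 2 / 4) :=
          add_le_add (hN n hn) (htail _ _ (hug n) (hu n) (hg n))
      _ = ENNReal.ofReal (ε ^ 2 / 2) := by
          rw [← ENNReal.ofReal_add (by positivity) (by positivity)]
          congr 1
          ring
  rw [ENNReal.ofReal_le_ofReal_iff (by positivity)] at h1
  rw [dist_zero_right]
  have := norm_nonneg (u n)
  nlinarith

end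

/-! ### Existence of the Neumann eigenbasis. -/

section

variable {d : ℕ} {Ω : Set (Eucl d)}

theorem exists_disjoint_isOpen (hd : 0 < d) {A : Set (Eucl d)} (hA : IsOpen A)
    (hne : A.Nonempty) : ∃ U : ℕ → Set (Eucl d), (∀ n, IsOpen (U n)) ∧ (∀ n, (U n).Nonempty) ∧
      (∀ n, U n ⊆ A) ∧ Pairwise (Function.onFun Disjoint U) := by
  obtain ⟨x, hx⟩ := hne
  have : Nonempty (Fin d) := ⟨⟨0, hd⟩⟩
  have : Nontrivial (Eucl d) := inferInstance
  have : (𝓝[≠] x).NeBot := Module.punctured_nhds_neBot ℝ (Eucl d) x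
  have : Infinite A := (infinite_of_mem_nhds x (hA.mem_nhds hx)).to_subtype
  obtain ⟨U, hU1, hU2, hU3⟩ := exists_seq_infinite_isOpen_pairwise_disjoint A
  refine ⟨fun n => Subtype.val '' U n, fun n => hA.isOpenMap_subtype_val _ (hU2 n),
    fun n => (hU1 n).nonempty.image _, fun n => Subtype.coe_image_subset _ _, fun i j hij => ?_⟩
  exact (Set.disjoint_image_iff Subtype.val_injective).2 (hU3 hij)

/-- Indicators of disjoint open subsets of `A` are nonzero and mutually orthogonal. -/
theorem not_finiteDimensional_of_support (hd : 0 < d) (hb : Bornology.IsBounded Ω)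
    {A : Set (Eucl d)} (hA : IsOpen A) (hne : A.Nonempty) (hAΩ : A ⊆ Ω) (W : Submodule ℝ (L2 Ω))
    (hW : ∀ f : L2 Ω, (∀ᵐ x ∂(volume.restrict Ω), x ∉ A → f x = 0) → f ∈ W) :
    ¬ FiniteDimensional ℝ W := by
  intro hfin
  obtain ⟨U, hUo, hUne, hUA, hUd⟩ := exists_disjoint_isOpen hd hA hne
  have hmem : ∀ n, MemLp ((U n).indicator fun _ => (1 : ℝ)) 2 (volume.restrict Ω) := fun n =>
    memLp_indicator_const 2 (hUo n).measurableSet 1 (Or.inr (ne_top_of_le_ne_top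
      hb.measure_lt_top.ne ((measure_mono (Set.subset_univ _)).trans
        (by rw [Measure.restrict_apply_univ]))))
  let w : ℕ → W := fun n => ⟨(hmem n).toLp _, hW _ (by
    filter_upwards [(hmem n).coeFn_toLp] with x hx hxA
    rw [hx, Set.indicator_of_notMem fun h => hxA (hUA n h)])⟩
  have hne0 : ∀ n, w n ≠ 0 := by
    intro n h0
    have h1 : (hmem n).toLp _ = 0 := congrArg Subtype.val h0
    have h2 := (Lp.eq_zero_iff_ae_eq_zero.1 h1)
    have h3 : ∀ᵐ x ∂(volume.restrict Ω), x ∉ U n := by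
      filter_upwards [h2, (hmem n).coeFn_toLp] with x hx1 hx2 hxU
      rw [hx2, Set.indicator_of_mem hxU] at hx1
      exact one_ne_zero hx1
    rw [ae_iff] at h3
    simp only [not_not] at h3
    have h4 : volume (U n) = 0 := by
      rw [← h3]
      change _ = (volume.restrict Ω) (U n)
      rw [Measure.restrict_apply (hUo n).measurableSet,
        Set.inter_eq_left.2 ((hUA n).trans hAΩ)]
    exact ((hUo n).measure_pos volume (hUne n)).ne' h4
  have hort : Pairwise fun i j => inner ℝ (w i) (w j) = 0 := by
    intro i j hij
    change inner ℝ ((hmem i).toLp _) ((hmem j).toLp _) = 0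
    rw [inner_toLp]
    refine integral_eq_zero_of_ae ?_
    filter_upwards [(hmem j).coeFn_toLp] with x hx
    rw [hx]
    by_cases hi : x ∈ U i
    · have : x ∉ U j := fun hj => Set.disjoint_left.1 (hUd hij) hi hj
      simp [this]
    · simp [hi]
  have hlin : LinearIndependent ℝ w := linearIndependent_of_ne_zero_of_inner_eq_zero hne0 hort
  exact not_finite_iff_infinite.2 inferInstance hlin.finite

theorem isWeakNeumannSolution_iff {u f : L2 Ω} : IsWeakNeumannSolution Ω u f ↔
    ∃ g : L2Vec Ω, IsWeakGradient Ω u g ∧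
      ∀ (w : L2 Ω) (h : L2Vec Ω), IsWeakGradient Ω w h → inner ℝ g h = inner ℝ f w := by
  simp_rw [inner_L2_eq, L2.inner_def]
  rfl

/-- The embedding of `H¹(Ω)` in `L²(Ω)`. -/
def sobolevEmbedding (Ω : Set (Eucl d)) : sobolev Ω →L[ℝ] L2 Ω :=
  (WithLp.fstL 2 ℝ (L2 Ω) (L2Vec Ω)).comp (sobolev Ω).subtypeL

instance completeSpace_sobolev : CompleteSpace (sobolev Ω) :=
  isClosed_sobolev.completeSpace_coe

theorem separableSpace_sobolev : TopologicalSpace.SeparableSpace (sobolev Ω) := by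
  have : Fact ((2 : ENNReal) ≠ ⊤) := ⟨by simp⟩
  have h1 : SecondCountableTopology (L2 Ω) := Lp.SecondCountableTopology
  have h2 : SecondCountableTopology (L2Vec Ω) := Lp.SecondCountableTopology
  have h3 : SecondCountableTopology (WithLp 2 (L2 Ω × L2Vec Ω)) :=
    (WithLp.homeomorphProd 2 (L2 Ω) (L2Vec Ω)).isInducing.secondCountableTopology
  infer_instance

theorem isCompactOperator_sobolevEmbedding (hΩ : IsLipschitzDomain Ω)
    (hb : Bornology.IsBounded Ω) : IsCompactOperator (sobolevEmbedding Ω) := by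
  have := separableSpace_sobolev (Ω := Ω)
  refine isCompactOperator_of_weakly_null _ fun x C hx hweak => ?_
  refine rellich hΩ hb (C := C) (u := fun n => (x n).1.fst) (g := fun n => (x n).1.snd)
    (fun n => (x n).2) (fun n => ?_) (fun n => ?_) fun z => ?_
  · exact (WithLp.norm_fst_le _ _).trans (hx n)
  · exact (WithLp.norm_snd_le _ _).trans (hx n)
  · refine (hweak ((sobolevEmbedding Ω).adjoint z)).congr fun n => ?_
    rw [ContinuousLinearMap.adjoint_inner_right]
    rfl

/-- The solution operator of `-Δu + u = f` with Neumann boundary condition. -/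
theorem exists_resolvent (hΩ : IsLipschitzDomain Ω) (hb : Bornology.IsBounded Ω) :
    ∃ (S : L2 Ω →L[ℝ] L2 Ω) (G : L2 Ω → L2Vec Ω), IsCompactOperator S ∧
      (∀ f, IsWeakGradient Ω (S f) (G f)) ∧
      ∀ (f w : L2 Ω) (h : L2Vec Ω), IsWeakGradient Ω w h →
        inner ℝ (S f) w + inner ℝ (G f) h = inner ℝ f w := by
  -- With J the embedding, ⟨J* f, (w, h)⟩ in H¹ equals ⟨f, w⟩, which is the weak equation for J* f.
  -- Hence S = J J*.
  refine ⟨sobolevEmbedding Ω ∘L (sobolevEmbedding Ω).adjoint,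
    fun f => ((sobolevEmbedding Ω).adjoint f).1.snd,
    (isCompactOperator_sobolevEmbedding hΩ hb).comp_clm _,
    fun f => ((sobolevEmbedding Ω).adjoint f).2, fun f w h hwh => ?_⟩
  exact ContinuousLinearMap.adjoint_inner_left (sobolevEmbedding Ω)
    (⟨WithLp.toLp 2 (w, h), hwh⟩ : sobolev Ω) f

/-- The Neumann Laplacian of a bounded Lipschitz domain has an orthonormal eigenbasis. -/
theorem exists_isNeumannEigenbasis (hd : 0 < d) (hΩ : IsLipschitzDomain Ω)
    (hb : Bornology.IsBounded Ω) :
    ∃ (χ : ℕ → L2 Ω) (μ : ℕ → ℝ), IsNeumannEigenbasis Ω χ μ := by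
  obtain ⟨S, G, hSc, hSG, hS⟩ := exists_resolvent hΩ hb
  have hSs : IsSelfAdjoint S := by
    rw [ContinuousLinearMap.isSelfAdjoint_iff_isSymmetric]
    intro x y
    change inner ℝ (S x) y = inner ℝ x (S y)
    rw [real_inner_comm, ← hS y _ _ (hSG x), ← hS x _ _ (hSG y), real_inner_comm (S x),
      real_inner_comm (G x)]
  have hSx : ∀ x, inner ℝ (S x) x = ‖S x‖ ^ 2 + ‖G x‖ ^ 2 := fun x => by
    rw [real_inner_comm, ← hS x _ _ (hSG x), real_inner_self_eq_norm_sq,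
      real_inner_self_eq_norm_sq]
  -- If `S f = 0`, the energy identity `hSx` also kills `G f`, and the weak equation makes f
  -- orthogonal to all test functions.
  have hker : LinearMap.ker (S : L2 Ω →ₗ[ℝ] L2 Ω) = ⊥ := by
    rw [eq_bot_iff, ← testSpan_orthogonal hΩ.isOpen]
    intro f hf
    have h1 : S f = 0 := hf
    have h2 : G f = 0 := by
      have := hSx f
      rw [h1, inner_zero_left, norm_zero] at this
      have h3 : ‖G f‖ ^ 2 = 0 := by linarith
      exact norm_eq_zero.1 (pow_eq_zero_iff two_ne_zero |>.1 h3)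
    rw [Submodule.mem_orthogonal]
    intro v hv
    induction hv using Submodule.span_induction with
    | mem v hv =>
      obtain ⟨ψ, hψ, rfl⟩ := hv
      obtain ⟨g, hg⟩ := hψ.isWeakGradient
      have := hS f _ g hg
      rw [h1, h2, inner_zero_left, inner_zero_left, add_zero] at this
      rw [real_inner_comm]
      exact this.symm
    | zero => simp
    | add a b _ _ ha hb => rw [inner_add_left, ha, hb, add_zero]
    | smul c a _ ha => rw [inner_smul_left, ha, mul_zero]
  have hnn : ∀ x, 0 ≤ inner ℝ (S x) x := fun x => by rw [hSx]; positivity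
  obtain ⟨w, s, hw, hs, hspos, -, hSw, hspan⟩ := exists_antitone_eigenbasis hSc hSs hnn
    (not_finiteDimensional_of_support hd hb hΩ.isOpen hΩ.isConnected.nonempty subset_rfl _
      fun f _ => by rw [hker, Submodule.bot_orthogonal_eq_top]; trivial)
  -- S inverts −Δ + 1, so S w = s w reads −Δ w = (1/s − 1) w.
  refine ⟨w, fun k => (s k)⁻¹ - 1, hw, ?_, fun k => ?_, fun i j hij => ?_⟩
  · rw [hspan, hker, Submodule.bot_orthogonal_eq_top]
  · rw [isWeakNeumannSolution_iff]
    refine ⟨(s k)⁻¹ • G (w k), ?_, fun u h huh => ?_⟩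
    · have h2 := (hSG (w k)).smul (s k)⁻¹
      rwa [hSw k, smul_smul, inv_mul_cancel₀ (hspos k).ne', one_smul] at h2
    · have h1 := hS (w k) u h huh
      rw [hSw k, real_inner_smul_left] at h1
      have h2 : inner ℝ (G (w k)) h = (1 - s k) * inner ℝ (w k) u := by linarith
      rw [real_inner_smul_left, real_inner_smul_left, h2]
      have := (hspos k).ne'
      field_simp
  · exact sub_le_sub_right (inv_anti₀ (hspos j) (hs hij)) 1

end

/-! ### Properties of any Neumann eigenbasis and of the inverse square root. -/

section

section Hilbert

variable {H : Type*} [NormedAddCommGroup H] [InnerProductSpace ℝ H]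

theorem hasSum_of_forall_eq {f g : ℕ → ℝ} {a : ℝ} (h : HasSum f a) (hgf : ∀ k, g k = f k) :
    HasSum g a :=
  (funext hgf : g = f) ▸ h

theorem inner_of_hasSum_orthonormal {e : ℕ → H} (he : Orthonormal ℝ e) {c : ℕ → ℝ} {y : H}
    (hy : HasSum (fun k => c k • e k) y) (j : ℕ) : inner ℝ (e j) y = c j := by
  have h1 := hy.mapL (innerSL ℝ (e j))
  simp only [innerSL_apply_apply, inner_smul_right] at h1
  have h2 : HasSum (fun k => c k * inner ℝ (e j) (e k)) (c j * inner ℝ (e j) (e j)) := by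
    refine hasSum_single j fun k hk => ?_
    rw [he.2 hk.symm, mul_zero]
  rw [h1.unique h2, real_inner_self_eq_norm_sq, he.1]
  simp

theorem hasSum_inner_diagonal {e : ℕ → H} {a : ℕ → ℝ} {x y : H}
    (hy : HasSum (fun k => (a k * inner ℝ (e k) x) • e k) y) (z : H) :
    HasSum (fun k => a k * inner ℝ (e k) x * inner ℝ (e k) z) (inner ℝ y z) := by
  have h1 := hy.mapL (innerSL ℝ z)
  simp only [innerSL_apply_apply, inner_smul_right] at h1
  rw [real_inner_comm]
  exact hasSum_of_forall_eq h1 fun k => by rw [real_inner_comm (e k) z]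

theorem isSymmetric_of_diagonal {e : ℕ → H} {a : ℕ → ℝ} {T : H →L[ℝ] H}
    (hT : ∀ x, HasSum (fun k => (a k * inner ℝ (e k) x) • e k) (T x)) (x y : H) :
    inner ℝ (T x) y = inner ℝ x (T y) := by
  have h1 := hasSum_inner_diagonal (hT x) y
  have h2 := hasSum_inner_diagonal (hT y) x
  rw [real_inner_comm (T y) x]
  exact h1.unique (hasSum_of_forall_eq h2 fun k => by ring)

theorem eq_zero_of_forall_inner [CompleteSpace H] {w : ℕ → H} {x : H}
    (hx : x ∈ (Submodule.span ℝ (Set.range w)).topologicalClosure)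
    (h : ∀ k, inner ℝ (w k) x = 0) : x = 0 := by
  rw [← Submodule.orthogonal_orthogonal_eq_closure] at hx
  have h1 : x ∈ (Submodule.span ℝ (Set.range w))ᗮ := mem_orthogonal_span_range.2 h
  exact inner_self_eq_zero.1 ((Submodule.mem_orthogonal _ _).1 hx x h1)

theorem mem_span_image_of_inner_eq_zero [CompleteSpace H] {w : ℕ → H} (hw : Orthonormal ℝ w)
    {x : H} (hx : x ∈ (Submodule.span ℝ (Set.range w)).topologicalClosure) {F : Set ℕ}
    (hF : F.Finite) (h : ∀ k, k ∉ F → inner ℝ (w k) x = 0) : x ∈ Submodule.span ℝ (w '' F) := by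
  set y := ∑ k ∈ hF.toFinset, (inner ℝ (w k) x : ℝ) • w k with hy
  have hymem : ∀ k, w k ∈ (Submodule.span ℝ (Set.range w)).topologicalClosure := fun k =>
    Submodule.le_topologicalClosure _ (Submodule.subset_span ⟨k, rfl⟩)
  have h0 : x - y = 0 := by
    refine eq_zero_of_forall_inner (w := w)
      (Submodule.sub_mem _ hx (Submodule.sum_mem _ fun k _ => Submodule.smul_mem _ _ (hymem k)))
      fun k => ?_
    rw [inner_sub_right, hy]
    by_cases hk : k ∈ F
    · rw [hw.inner_right_sum _ (hF.mem_toFinset.2 hk), sub_self]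
    · rw [h k hk, inner_sum, Finset.sum_eq_zero, sub_zero]
      intro j hj
      rw [inner_smul_right, hw.2, mul_zero]
      rintro rfl
      exact hk (hF.mem_toFinset.1 hj)
  rw [sub_eq_zero.1 h0]
  exact Submodule.sum_mem _ fun k hk => Submodule.smul_mem _ _
    (Submodule.subset_span ⟨k, hF.mem_toFinset.1 hk, rfl⟩)

end Hilbert

variable {d : ℕ} {Ω : Set (Eucl d)} {χ : ℕ → L2 Ω} {μ : ℕ → ℝ}

theorem constL2_eq_smul (hb : Bornology.IsBounded Ω) (c : ℝ) :
    constL2 hb c = c • constL2 hb 1 := by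
  refine Lp.ext ?_
  filter_upwards [constL2_ae hb c, constL2_ae hb 1, Lp.coeFn_smul c (constL2 hb 1)]
    with x h1 h2 h3
  rw [h1, h3, Pi.smul_apply, h2, smul_eq_mul, mul_one]

theorem constL2_one_ne_zero (hΩ : IsOpen Ω) (hne : Ω.Nonempty) (hb : Bornology.IsBounded Ω) :
    constL2 hb 1 ≠ 0 := by
  intro h
  have : (ae (volume.restrict Ω)).NeBot :=
    ae_neBot.2 (by rw [Ne, Measure.restrict_eq_zero]; exact (hΩ.measure_pos volume hne).ne')
  obtain ⟨x, hx1, hx2⟩ := ((Lp.eq_zero_iff_ae_eq_zero.1 h).and (constL2_ae hb 1)).exists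
  rw [hx2] at hx1
  exact one_ne_zero hx1

namespace IsNeumannEigenbasis

/-- The weak gradients of the eigenfunctions. -/
theorem exists_gradient (hχ : IsNeumannEigenbasis Ω χ μ) :
    ∃ G : ℕ → L2Vec Ω, (∀ k, IsWeakGradient Ω (χ k) (G k)) ∧
      ∀ (k : ℕ) (w : L2 Ω) (h : L2Vec Ω), IsWeakGradient Ω w h →
        inner ℝ (G k) h = μ k * inner ℝ (χ k) w := by
  choose G hG1 hG2 using fun k => isWeakNeumannSolution_iff.1 (hχ.eigen k)
  exact ⟨G, hG1, fun k w h hwh => by rw [hG2 k w h hwh, real_inner_smul_left]⟩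

theorem eq_zero (hχ : IsNeumannEigenbasis Ω χ μ) {f : L2 Ω} (h : ∀ k, inner ℝ (χ k) f = 0) :
    f = 0 :=
  eq_zero_of_forall_inner (by rw [hχ.complete]; trivial) h

theorem eigenvalue_eq {G : ℕ → L2Vec Ω} (hχ : IsNeumannEigenbasis Ω χ μ)
    (hG : ∀ k, IsWeakGradient Ω (χ k) (G k))
    (hG' : ∀ (k : ℕ) (w : L2 Ω) (h : L2Vec Ω), IsWeakGradient Ω w h →
      inner ℝ (G k) h = μ k * inner ℝ (χ k) w) (k : ℕ) : ‖G k‖ ^ 2 = μ k := by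
  rw [← real_inner_self_eq_norm_sq, hG' k _ _ (hG k), real_inner_self_eq_norm_sq,
    hχ.orthonormal.1]
  simp

theorem nonneg (hχ : IsNeumannEigenbasis Ω χ μ) (k : ℕ) : 0 ≤ μ k := by
  obtain ⟨G, hG, hG'⟩ := hχ.exists_gradient
  rw [← hχ.eigenvalue_eq hG hG' k]
  positivity

/-- Otherwise all eigenvalues are positive by monotonicity. Testing with 1, whose gradient vanishes,
then makes 1 orthogonal to the whole basis. -/
theorem eigenvalue_zero (hχ : IsNeumannEigenbasis Ω χ μ) (hΩ : IsLipschitzDomain Ω)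
    (hb : Bornology.IsBounded Ω) : μ 0 = 0 := by
  obtain ⟨G, hG, hG'⟩ := hχ.exists_gradient
  by_contra hne
  have hpos : 0 < μ 0 := lt_of_le_of_ne (hχ.nonneg 0) (Ne.symm hne)
  refine constL2_one_ne_zero hΩ.isOpen hΩ.isConnected.nonempty hb (hχ.eq_zero fun k => ?_)
  have := hG' k _ _ (isWeakGradient_constL2 hb 1)
  rw [inner_zero_right] at this
  exact (mul_eq_zero.1 this.symm).resolve_left
    (hpos.trans_le (hχ.monotone (Nat.zero_le k))).ne'

theorem exists_const (hχ : IsNeumannEigenbasis Ω χ μ) (hΩ : IsLipschitzDomain Ω)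
    (hb : Bornology.IsBounded Ω) {k : ℕ} (hk : μ k = 0) : ∃ c, χ k = constL2 hb c := by
  obtain ⟨G, hG, hG'⟩ := hχ.exists_gradient
  have h1 := hχ.eigenvalue_eq hG hG' k
  rw [hk] at h1
  have h2 : G k = 0 := norm_eq_zero.1 (pow_eq_zero_iff two_ne_zero |>.1 h1)
  have h3 := hG k
  rw [h2] at h3
  exact eq_constL2_of_gradient_zero hΩ.isOpen hΩ.isConnected.isPreconnected hb h3

/-- A second eigenfunction for 0 would be a nonzero constant, like `χ 0`, and two nonzero constants
are not orthogonal. -/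
theorem eigenvalue_succ_pos (hχ : IsNeumannEigenbasis Ω χ μ) (hΩ : IsLipschitzDomain Ω)
    (hb : Bornology.IsBounded Ω) (k : ℕ) : 0 < μ (k + 1) := by
  refine lt_of_le_of_ne (hχ.nonneg _) fun h => ?_
  obtain ⟨a, ha⟩ := hχ.exists_const hΩ hb (hχ.eigenvalue_zero hΩ hb)
  obtain ⟨b, hb'⟩ := hχ.exists_const hΩ hb h.symm
  have h0 := hχ.orthonormal.ne_zero 0
  have h1 := hχ.orthonormal.ne_zero (k + 1)
  have h2 : inner ℝ (χ 0) (χ (k + 1)) = 0 := hχ.orthonormal.2 (Nat.succ_ne_zero k).symm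
  rw [constL2_eq_smul] at ha hb'
  rw [ha, hb', real_inner_smul_left, real_inner_smul_right] at h2
  rw [ha] at h0
  rw [hb'] at h1
  have h3 := constL2_one_ne_zero hΩ.isOpen hΩ.isConnected.nonempty hb
  rcases mul_eq_zero.1 h2 with h | h
  · exact h0 (by rw [h, zero_smul])
  · rcases mul_eq_zero.1 h with h | h
    · exact h1 (by rw [h, zero_smul])
    · exact h3 (inner_self_eq_zero.1 h)

/-- If the eigenvalues were bounded, the eigenfunctions would be bounded in H¹ and weakly null, so
`rellich` would force their unit norms to 0. -/
theorem tendsto_atTop (hχ : IsNeumannEigenbasis Ω χ μ) (hΩ : IsLipschitzDomain Ω)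
    (hb : Bornology.IsBounded Ω) : Tendsto μ atTop atTop := by
  obtain ⟨G, hG, hG'⟩ := hχ.exists_gradient
  refine tendsto_atTop_atTop_of_monotone hχ.monotone fun b => ?_
  by_contra! hcon
  have h1 : Tendsto χ atTop (𝓝 0) := by
    refine rellich hΩ hb (C := max 1 √b) hG (fun n => ?_) (fun n => ?_)
      (fun z => tendsto_inner_of_orthonormal hχ.orthonormal z)
    · rw [hχ.orthonormal.1]
      exact le_max_left _ _
    · refine le_trans ?_ (le_max_right _ _)
      refine Real.le_sqrt_of_sq_le ?_
      rw [hχ.eigenvalue_eq hG hG']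
      exact (hcon n).le
  have h2 := h1.norm
  simp only [hχ.orthonormal.1, norm_zero] at h2
  exact one_ne_zero (tendsto_nhds_unique tendsto_const_nhds h2)

theorem orthonormal_succ (hχ : IsNeumannEigenbasis Ω χ μ) :
    Orthonormal ℝ fun k => χ (k + 1) :=
  hχ.orthonormal.comp _ (add_left_injective 1)

theorem tendsto_coeff (hχ : IsNeumannEigenbasis Ω χ μ) (hΩ : IsLipschitzDomain Ω)
    (hb : Bornology.IsBounded Ω) : Tendsto (fun k => (√(μ (k + 1)))⁻¹) atTop (𝓝 0) :=
  tendsto_inv_atTop_zero.comp (Real.tendsto_sqrt_atTop.comp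
    ((hχ.tendsto_atTop hΩ hb).comp (tendsto_add_atTop_nat 1)))

theorem exists_invSqrt (hχ : IsNeumannEigenbasis Ω χ μ) (hΩ : IsLipschitzDomain Ω)
    (hb : Bornology.IsBounded Ω) : ∃ T : L2 Ω →L[ℝ] L2 Ω, IsInvSqrtNeumann χ μ T := by
  refine exists_diagonal (C := (√(μ 1))⁻¹) hχ.orthonormal_succ hχ.orthonormal_succ fun k => ?_
  rw [abs_of_nonneg (by positivity)]
  exact inv_anti₀ (Real.sqrt_pos.2 (hχ.eigenvalue_succ_pos hΩ hb 0))
    (Real.sqrt_le_sqrt (hχ.monotone (by omega)))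

variable {T : L2 Ω →L[ℝ] L2 Ω}

theorem isCompactOperator (hχ : IsNeumannEigenbasis Ω χ μ) (hΩ : IsLipschitzDomain Ω)
    (hb : Bornology.IsBounded Ω) (hT : IsInvSqrtNeumann χ μ T) : IsCompactOperator T :=
  isCompactOperator_of_diagonal hχ.orthonormal_succ hχ.orthonormal_succ
    (hχ.tendsto_coeff hΩ hb) hT

theorem inner_succ_invSqrt (hχ : IsNeumannEigenbasis Ω χ μ) (hT : IsInvSqrtNeumann χ μ T)
    (f : L2 Ω) (k : ℕ) :
    inner ℝ (χ (k + 1)) (T f) = (√(μ (k + 1)))⁻¹ * inner ℝ (χ (k + 1)) f :=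
  inner_of_hasSum_orthonormal hχ.orthonormal_succ (hT f) k

theorem inner_zero_invSqrt (hχ : IsNeumannEigenbasis Ω χ μ) (hT : IsInvSqrtNeumann χ μ T)
    (f : L2 Ω) : inner ℝ (χ 0) (T f) = 0 := by
  have h1 := (hT f).mapL (innerSL ℝ (χ 0))
  simp only [innerSL_apply_apply, inner_smul_right] at h1
  refine h1.unique ?_
  convert hasSum_zero with k
  rw [hχ.orthonormal.2 (Nat.succ_ne_zero k).symm, mul_zero]

theorem eq_zero_of_invSqrt_eq_zero (hχ : IsNeumannEigenbasis Ω χ μ) (hΩ : IsLipschitzDomain Ω)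
    (hb : Bornology.IsBounded Ω) (hT : IsInvSqrtNeumann χ μ T) {f : L2 Ω}
    (h0 : inner ℝ (χ 0) f = 0) (hf : T f = 0) : f = 0 := by
  refine hχ.eq_zero fun k => ?_
  rcases k with _ | k
  · exact h0
  · have h1 := hχ.inner_succ_invSqrt hT f k
    rw [hf, inner_zero_right] at h1
    exact (mul_eq_zero.1 h1.symm).resolve_left
      (inv_ne_zero (Real.sqrt_pos.2 (hχ.eigenvalue_succ_pos hΩ hb k)).ne')

/-- The fields μ_k^{-1/2}∇χ_k are orthonormal. The termwise gradient of the series for `T f`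
therefore converges for every f in L²(Ω), and `T f` lies in H¹. -/
theorem exists_gradient_invSqrt (hχ : IsNeumannEigenbasis Ω χ μ) (hΩ : IsLipschitzDomain Ω)
    (hb : Bornology.IsBounded Ω) (hT : IsInvSqrtNeumann χ μ T) (f : L2 Ω) :
    ∃ W : L2Vec Ω, IsWeakGradient Ω (T f) W ∧ ∀ (w : L2 Ω) (h : L2Vec Ω), IsWeakGradient Ω w h →
      HasSum (fun k => √(μ (k + 1)) * inner ℝ (χ (k + 1)) f * inner ℝ (χ (k + 1)) w)
        (inner ℝ W h) := by
  obtain ⟨G, hG, hG'⟩ := hχ.exists_gradient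
  have hμ := hχ.eigenvalue_succ_pos hΩ hb
  have hγ : Orthonormal ℝ fun k => (√(μ (k + 1)))⁻¹ • G (k + 1) := by
    refine ⟨fun k => ?_, fun i j hij => ?_⟩
    · rw [norm_smul, ← Real.sqrt_sq (norm_nonneg (G (k + 1))), hχ.eigenvalue_eq hG hG',
        norm_inv, Real.norm_of_nonneg (Real.sqrt_nonneg _)]
      exact inv_mul_cancel₀ (Real.sqrt_pos.2 (hμ k)).ne'
    · change inner ℝ _ _ = 0
      rw [real_inner_smul_left, real_inner_smul_right, hG' _ _ _ (hG (j + 1)),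
        hχ.orthonormal.2 (by simpa using hij)]
      simp
  obtain ⟨W, hW⟩ := exists_diagonal (a := fun _ => 1) (C := 1) hχ.orthonormal_succ hγ
    (fun _ => by simp)
  refine ⟨W f, IsWeakGradient.hasSum (fun k => ?_) (hT f) (hW f), fun w h hwh => ?_⟩
  · have h1 := (hG (k + 1)).smul ((√(μ (k + 1)))⁻¹ * inner ℝ (χ (k + 1)) f)
    rw [smul_smul, one_mul, mul_comm (inner ℝ (χ (k + 1)) f)]
    exact h1
  · have h1 := (hW f).mapL (innerSL ℝ h)
    simp only [innerSL_apply_apply, inner_smul_right] at h1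
    rw [real_inner_comm]
    refine hasSum_of_forall_eq h1 fun k => ?_
    rw [real_inner_comm (G (k + 1)) h, hG' _ _ _ hwh]
    have h2 := Real.mul_self_sqrt (hμ k).le
    have h3 := (Real.sqrt_pos.2 (hμ k)).ne'
    nth_rewrite 3 [← h2]
    field_simp

/-- `(-Δ)^{-1/2}(-Δ)^{-1/2} f` solves the Neumann problem with right-hand side `f`. -/
theorem isWeakNeumannSolution_invSqrt (hχ : IsNeumannEigenbasis Ω χ μ)
    (hΩ : IsLipschitzDomain Ω) (hb : Bornology.IsBounded Ω) (hT : IsInvSqrtNeumann χ μ T)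
    {f : L2 Ω} (hf : inner ℝ (χ 0) f = 0) (c : ℝ) :
    IsWeakNeumannSolution Ω (T (T f) - constL2 hb c) f := by
  obtain ⟨W, hW, hW'⟩ := hχ.exists_gradient_invSqrt hΩ hb hT (T f)
  rw [isWeakNeumannSolution_iff]
  refine ⟨W, by simpa using hW.sub (isWeakGradient_constL2 hb c), fun w h hwh => ?_⟩
  have hbasis := (HilbertBasis.mk hχ.orthonormal hχ.complete.ge).hasSum_inner_mul_inner f w
  simp only [HilbertBasis.coe_mk] at hbasis
  -- The term of index 0 in Parseval's identity drops out because f is orthogonal to `χ 0`.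
  rw [← hasSum_nat_add_iff' 1] at hbasis
  simp only [Finset.sum_range_one, real_inner_comm (χ 0) f, hf, zero_mul, sub_zero] at hbasis
  refine (hW' w h hwh).unique (hasSum_of_forall_eq hbasis fun k => ?_)
  rw [hχ.inner_succ_invSqrt hT, ← mul_assoc,
    mul_inv_cancel₀ (Real.sqrt_pos.2 (hχ.eigenvalue_succ_pos hΩ hb k)).ne', one_mul,
    real_inner_comm f]

/-- A weak solution of the Neumann problem is determined by its right-hand side up to a
constant. -/
theorem eq_of_isWeakNeumannSolution (hχ : IsNeumannEigenbasis Ω χ μ) (hΩ : IsLipschitzDomain Ω)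
    (hb : Bornology.IsBounded Ω) (hT : IsInvSqrtNeumann χ μ T) {u f : L2 Ω}
    (hu : IsWeakNeumannSolution Ω u f) : ∃ c : ℝ, u = T (T f) + c • constL2 hb 1 := by
  obtain ⟨g, hg, hg'⟩ := isWeakNeumannSolution_iff.1 hu
  obtain ⟨G, hG, hG'⟩ := hχ.exists_gradient
  -- Testing with `χ k` determines every coefficient of u except the one of index 0, where μ
  -- vanishes: this is the free constant.
  have hcoef : ∀ k, μ k * inner ℝ (χ k) u = inner ℝ (χ k) f := fun k => by
    rw [← hG' k u g hg, real_inner_comm, hg' _ _ (hG k), real_inner_comm]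
  obtain ⟨a, ha⟩ := hχ.exists_const hΩ hb (hχ.eigenvalue_zero hΩ hb)
  have h0 : u - T (T f) - (inner ℝ (χ 0) u : ℝ) • χ 0 = 0 := by
    refine hχ.eq_zero fun k => ?_
    rw [inner_sub_right, inner_sub_right, inner_smul_right]
    rcases k with _ | k
    · rw [hχ.inner_zero_invSqrt hT, real_inner_self_eq_norm_sq, hχ.orthonormal.1]
      ring
    · rw [hχ.inner_succ_invSqrt hT, hχ.inner_succ_invSqrt hT, ← hcoef,
        hχ.orthonormal.2 (Nat.succ_ne_zero k)]
      have h2 := Real.mul_self_sqrt (hχ.eigenvalue_succ_pos hΩ hb k).le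
      have h3 := (Real.sqrt_pos.2 (hχ.eigenvalue_succ_pos hΩ hb k)).ne'
      nth_rewrite 3 [← h2]
      field_simp
      ring
  refine ⟨inner ℝ (χ 0) u * a, ?_⟩
  rw [mul_smul, ← constL2_eq_smul, ← ha, ← sub_eq_zero, ← h0]
  abel

end IsNeumannEigenbasis

end

/-! ### Cutoff, centering, and the degenerate eigenvalue problem. -/

section

variable {d : ℕ} {Ω D : Set (Eucl d)}

theorem cutoff_ae (hD : IsLipschitzDomain D) (u : L2 Ω) :
    cutoff hD u =ᵐ[volume.restrict Ω] D.indicator u :=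
  MemLp.coeFn_toLp _

theorem inner_cutoff_left (hD : IsLipschitzDomain D) (hDΩ : D ⊆ Ω) (u w : L2 Ω) :
    inner ℝ (cutoff hD u) w = ∫ x in D, u x * w x := by
  rw [inner_L2_eq]
  have h1 : ∫ x in Ω, cutoff hD u x * w x = ∫ x in Ω, D.indicator (fun x => u x * w x) x := by
    refine integral_congr_ae ?_
    filter_upwards [cutoff_ae hD u] with x hx
    rw [hx]
    by_cases h : x ∈ D <;> simp [h]
  rw [h1, integral_indicator hD.isOpen.measurableSet,
    Measure.restrict_restrict hD.isOpen.measurableSet, Set.inter_eq_left.2 hDΩ]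

theorem inner_cutoff_comm (hD : IsLipschitzDomain D) (hDΩ : D ⊆ Ω) (u w : L2 Ω) :
    inner ℝ (cutoff hD u) w = inner ℝ u (cutoff hD w) := by
  rw [inner_cutoff_left hD hDΩ, real_inner_comm, inner_cutoff_left hD hDΩ]
  simp_rw [mul_comm]

theorem cutoff_cutoff (hD : IsLipschitzDomain D) (u : L2 Ω) :
    cutoff hD (cutoff hD u) = cutoff hD u := by
  refine Lp.ext ?_
  filter_upwards [cutoff_ae hD (cutoff hD u), cutoff_ae hD u] with x h1 h2
  rw [h1, h2]
  by_cases h : x ∈ D <;> simp [h, h2]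

theorem cutoff_eq_self (hD : IsLipschitzDomain D) {u : L2 Ω}
    (hu : ∀ᵐ x ∂(volume.restrict Ω), x ∉ D → u x = 0) : cutoff hD u = u := by
  refine Lp.ext ?_
  filter_upwards [cutoff_ae hD u, hu] with x h1 h2
  rw [h1]
  by_cases h : x ∈ D <;> simp [h]
  exact (h2 h).symm

theorem exists_cutoffL (hD : IsLipschitzDomain D) :
    ∃ P : L2 Ω →L[ℝ] L2 Ω, ∀ u, P u = cutoff hD u := by
  refine ⟨LinearMap.mkContinuous
    { toFun := cutoff hD
      map_add' := fun u w => Lp.ext ?_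
      map_smul' := fun c u => Lp.ext ?_ } 1 fun u => ?_, fun u => rfl⟩
  · filter_upwards [cutoff_ae hD (u + w), cutoff_ae hD u, cutoff_ae hD w, Lp.coeFn_add u w,
      Lp.coeFn_add (cutoff hD u) (cutoff hD w)] with x h1 h2 h3 h4 h5
    rw [h1, h5, Pi.add_apply, h2, h3]
    by_cases h : x ∈ D
    · simp only [Set.indicator_of_mem h]
      exact h4
    · simp only [Set.indicator_of_notMem h, add_zero]
  · filter_upwards [cutoff_ae hD (c • u), cutoff_ae hD u, Lp.coeFn_smul c u,
      Lp.coeFn_smul c (cutoff hD u)] with x h1 h2 h3 h4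
    rw [h1, RingHom.id_apply, h4, Pi.smul_apply, h2]
    by_cases h : x ∈ D <;> simp [h, h3]
  · rw [one_mul]
    refine Lp.norm_le_norm_of_ae_le ?_
    filter_upwards [cutoff_ae hD u] with x h1
    change ‖cutoff hD u x‖ ≤ _
    rw [h1]
    exact norm_indicator_le_norm_self _ _

theorem setIntegral_eq_inner (hD : IsLipschitzDomain D) (hDΩ : D ⊆ Ω)
    (hb : Bornology.IsBounded Ω) (u : L2 Ω) :
    ∫ x in D, u x = inner ℝ (cutoff hD (constL2 hb 1)) u := by
  rw [inner_cutoff_left hD hDΩ]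
  refine integral_congr_ae ?_
  filter_upwards [ae_restrict_of_ae_restrict_of_subset hDΩ (constL2_ae hb 1)] with x hx
  rw [hx, one_mul]

section Centering

/-- `f - |D|⁻¹ ∫_D f`. -/
def center (D : Set (Eucl d)) (hb : Bornology.IsBounded Ω) (f : L2 Ω) : L2 Ω :=
  f - constL2 hb (⨍ x in D, f x)

theorem inner_cutoff_one (hD : IsLipschitzDomain D) (hDΩ : D ⊆ Ω)
    (hb : Bornology.IsBounded Ω) : inner ℝ (cutoff hD (constL2 hb 1)) (constL2 hb 1) = volume.real D := by
  rw [← setIntegral_eq_inner hD hDΩ hb]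
  have : ∫ x in D, constL2 hb 1 x = ∫ x in D, (1 : ℝ) :=
    integral_congr_ae (ae_restrict_of_ae_restrict_of_subset hDΩ (constL2_ae hb 1))
  rw [this]
  simp

theorem volume_real_pos (hD : IsLipschitzDomain D) (hDΩ : D ⊆ Ω)
    (hb : Bornology.IsBounded Ω) : 0 < volume.real D :=
  ENNReal.toReal_pos (hD.isOpen.measure_pos volume hD.isConnected.nonempty).ne'
    (hb.subset hDΩ).measure_lt_top.ne

theorem center_eq (hD : IsLipschitzDomain D) (hDΩ : D ⊆ Ω)
    (hb : Bornology.IsBounded Ω) (f : L2 Ω) : center D hb f =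
    f - ((volume.real D)⁻¹ * inner ℝ (cutoff hD (constL2 hb 1)) f) • constL2 hb 1 := by
  rw [center, constL2_eq_smul, setAverage_eq, setIntegral_eq_inner hD hDΩ hb, smul_eq_mul]

theorem exists_centerL (hD : IsLipschitzDomain D) (hDΩ : D ⊆ Ω)
    (hb : Bornology.IsBounded Ω) : ∃ P : L2 Ω →L[ℝ] L2 Ω, ∀ f, P f = center D hb f :=
  ⟨ContinuousLinearMap.id ℝ (L2 Ω) - ((volume.real D)⁻¹ •
    innerSL ℝ (cutoff hD (constL2 hb 1))).smulRight (constL2 hb 1), fun f => by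
    rw [center_eq hD hDΩ hb]
    simp⟩

theorem inner_one_center (hD : IsLipschitzDomain D) (hDΩ : D ⊆ Ω)
    (hb : Bornology.IsBounded Ω) (f : L2 Ω) :
    inner ℝ (cutoff hD (constL2 hb 1)) (center D hb f) = 0 := by
  rw [center_eq hD hDΩ hb, inner_sub_right, inner_smul_right, inner_cutoff_one hD hDΩ hb]
  have := (volume_real_pos hD hDΩ hb).ne'
  field_simp
  ring

theorem center_one (hD : IsLipschitzDomain D) (hDΩ : D ⊆ Ω)
    (hb : Bornology.IsBounded Ω) : center D hb (constL2 hb 1) = 0 := by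
  rw [center_eq hD hDΩ hb, inner_cutoff_one hD hDΩ hb,
    inv_mul_cancel₀ (volume_real_pos hD hDΩ hb).ne', one_smul, sub_self]

theorem center_eq_self (hD : IsLipschitzDomain D) (hDΩ : D ⊆ Ω)
    (hb : Bornology.IsBounded Ω) {f : L2 Ω} (hf : inner ℝ (cutoff hD (constL2 hb 1)) f = 0) :
    center D hb f = f := by
  rw [center_eq hD hDΩ hb, hf, mul_zero, zero_smul, sub_zero]

/-- `f ↦ 1_D (f - |D|⁻¹ ∫_D f)` is an orthogonal projection. -/
theorem inner_cutoff_center (hD : IsLipschitzDomain D) (hDΩ : D ⊆ Ω)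
    (hb : Bornology.IsBounded Ω) (f g : L2 Ω) :
    inner ℝ (cutoff hD (center D hb f)) g =
      inner ℝ (cutoff hD (center D hb f)) (cutoff hD (center D hb g)) := by
  have h1 : inner ℝ (cutoff hD (center D hb f)) (constL2 hb 1) = 0 := by
    rw [inner_cutoff_comm hD hDΩ, real_inner_comm, inner_one_center hD hDΩ hb]
  rw [← inner_cutoff_comm hD hDΩ, cutoff_cutoff, center_eq hD hDΩ hb g, inner_sub_right,
    inner_smul_right, h1, mul_zero, sub_zero]

end Centering

/-- The weighted Neumann eigenvalue problem in terms of the operator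
`K = (-Δ)^{-1/2} 1_D ((-Δ)^{-1/2} + ℓ)`. -/
theorem IsNeumannEigenbasis.exists_degenerate_eigenbasis {χ : ℕ → L2 Ω} {μ : ℕ → ℝ}
    (hχ : IsNeumannEigenbasis Ω χ μ) (hd : 0 < d) (hΩ : IsLipschitzDomain Ω)
    (hb : Bornology.IsBounded Ω) (hD : IsLipschitzDomain D) (hDΩ : D ⊆ Ω)
    {T : L2 Ω →L[ℝ] L2 Ω} (hT : IsInvSqrtNeumann χ μ T) :
    ∃ K : L2 Ω →L[ℝ] L2 Ω, (∀ v, K v = T (cutoff hD (shifted D hb T v))) ∧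
      IsCompactOperator K ∧ IsSelfAdjoint K ∧ (∀ v, 0 ≤ inner ℝ (K v) v) ∧
      ∃ (lam : ℕ → ℝ) (v φ : ℕ → L2 Ω),
        (∀ k, 0 < lam k) ∧ Monotone lam ∧ Tendsto lam atTop atTop ∧
        (∀ k, φ k ≠ 0 ∧ IsWeakNeumannSolution Ω (φ k) (lam k • cutoff hD (φ k))) ∧
        (∀ k, ∫ x in D, φ k x = 0) ∧
        (∀ k l, k ≠ l → ∫ x in D, φ k x * φ l x = 0) ∧
        Orthonormal ℝ v ∧
        (Submodule.span ℝ (Set.range v)).topologicalClosure =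
          (LinearMap.ker (K : L2 Ω →ₗ[ℝ] L2 Ω))ᗮ ∧
        (∀ k, K (v k) = (lam k)⁻¹ • v k) ∧
        (∀ k, φ k = shifted D hb T (v k)) ∧
        (∀ (c : ℝ) (u : L2 Ω), c ≠ 0 →
          IsWeakNeumannSolution Ω u (c • cutoff hD u) →
          u ∈ Submodule.span ℝ (φ '' {k | lam k = c})) := by
  obtain ⟨P, hP⟩ := exists_cutoffL (Ω := Ω) hD
  obtain ⟨Z, hZ⟩ := exists_centerL hD hDΩ hb
  have hshift : ∀ v, shifted D hb T v = Z (T v) := fun v => (hZ (T v)).symm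
  have hTs : ∀ x y, inner ℝ (T x) y = inner ℝ x (T y) := isSymmetric_of_diagonal hT
  have hTc := hχ.isCompactOperator hΩ hb hT
  obtain ⟨a, ha⟩ := hχ.exists_const hΩ hb (hχ.eigenvalue_zero hΩ hb)
  rw [constL2_eq_smul] at ha
  have hproj : ∀ f g, inner ℝ (P (Z f)) g = inner ℝ (P (Z f)) (P (Z g)) := fun f g => by
    simp only [hP, hZ]
    exact inner_cutoff_center hD hDΩ hb f g
  have hsymm : ∀ f g, inner ℝ (P (Z f)) g = inner ℝ f (P (Z g)) := fun f g => by
    rw [hproj, real_inner_comm, ← hproj, real_inner_comm]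
  -- This is the solvability condition of the Neumann problem with right-hand side `P (Z f)`.
  have hzero : ∀ f, inner ℝ (χ 0) (P (Z f)) = 0 := fun f => by
    rw [ha, real_inner_smul_left, hP, hZ, ← inner_cutoff_comm hD hDΩ,
      inner_one_center hD hDΩ hb, mul_zero]
  obtain ⟨K, hK⟩ : ∃ K : L2 Ω →L[ℝ] L2 Ω, ∀ v, K v = T (P (Z (T v))) :=
    ⟨T ∘L P ∘L Z ∘L T, fun v => rfl⟩
  have hKc : IsCompactOperator K := by
    have : (K : L2 Ω → L2 Ω) = T ∘ (P ∘L Z ∘L T) := funext hK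
    rw [this]
    exact hTc.comp_clm (P ∘L Z ∘L T)
  have hKinner : ∀ x y, inner ℝ (K x) y = inner ℝ (P (Z (T x))) (P (Z (T y))) := fun x y => by
    rw [hK, hTs, hproj]
  have hKsymm : ∀ x y, inner ℝ (K x) y = inner ℝ x (K y) := fun x y => by
    rw [hKinner, real_inner_comm, ← hKinner, real_inner_comm]
  have hKs : IsSelfAdjoint K := by
    rw [ContinuousLinearMap.isSelfAdjoint_iff_isSymmetric]
    exact hKsymm
  have hKnn : ∀ x, 0 ≤ inner ℝ (K x) x := fun x => by
    rw [hKinner]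
    exact real_inner_self_nonneg
  -- `T` embeds the range of `P Z` in the complement of the kernel. That range plus the line through
  -- the indicator of `D` contains every function supported in `D`, so it is infinite-dimensional.
  have hinf : ¬ FiniteDimensional ℝ ((LinearMap.ker (K : L2 Ω →ₗ[ℝ] L2 Ω))ᗮ : Submodule ℝ (L2 Ω)) := by
    intro hfin
    set Q : L2 Ω →ₗ[ℝ] L2 Ω := ((P ∘L Z : L2 Ω →L[ℝ] L2 Ω) : L2 Ω →ₗ[ℝ] L2 Ω) with hQ
    have hQf : ∀ f, Q f = P (Z f) := fun f => rfl
    have hmem : ∀ f ∈ LinearMap.range Q,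
        (T : L2 Ω →ₗ[ℝ] L2 Ω) f ∈ (LinearMap.ker (K : L2 Ω →ₗ[ℝ] L2 Ω))ᗮ := by
      rintro _ ⟨f, rfl⟩
      rw [Submodule.mem_orthogonal]
      intro z hz
      have hz0 : K z = 0 := hz
      have h1 : P (Z (T z)) = 0 := by
        rw [← inner_self_eq_zero (𝕜 := ℝ), ← hKinner, hz0, inner_zero_left]
      change inner ℝ z (T (P (Z f))) = 0
      rw [← hTs, ← hsymm, h1, inner_zero_left]
    have hinj : Function.Injective ((T : L2 Ω →ₗ[ℝ] L2 Ω).restrict hmem) := by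
      rw [injective_iff_map_eq_zero]
      rintro ⟨_, f, rfl⟩ hf
      refine Subtype.ext (hχ.eq_zero_of_invSqrt_eq_zero hΩ hb hT ?_ (congrArg Subtype.val hf))
      exact hzero f
    have hfinQ : FiniteDimensional ℝ (LinearMap.range Q) := Module.Finite.of_injective _ hinj
    refine not_finiteDimensional_of_support hd hb hD.isOpen hD.isConnected.nonempty hDΩ
      (LinearMap.range Q ⊔ Submodule.span ℝ {cutoff hD (constL2 hb 1)}) (fun f hf => ?_)
      inferInstance
    have h1 : f = Q f + ((volume.real D)⁻¹ * inner ℝ (cutoff hD (constL2 hb 1)) f) •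
        cutoff hD (constL2 hb 1) := by
      rw [hQf, hZ, center_eq hD hDΩ hb, map_sub, map_smul, hP, hP, cutoff_eq_self hD hf]
      abel
    rw [h1]
    exact Submodule.add_mem_sup ⟨f, rfl⟩
      (Submodule.smul_mem _ _ (Submodule.mem_span_singleton_self _))
  obtain ⟨v, s, hv, hs, hspos, hs0, hKv, hspan⟩ := exists_antitone_eigenbasis hKc hKs hKnn hinf
  have hlam : Tendsto (fun k => (s k)⁻¹) atTop atTop :=
    tendsto_inv_nhdsGT_zero.comp (tendsto_nhdsWithin_iff.2 ⟨hs0, Eventually.of_forall hspos⟩)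
  refine ⟨K, fun v => by rw [hK, hP, hshift], hKc, hKs, hKnn, fun k => (s k)⁻¹, v,
    fun k => Z (T (v k)), fun k => inv_pos.2 (hspos k), fun i j hij => inv_anti₀ (hspos j) (hs hij),
    hlam, fun k => ⟨fun h0 => ?_, ?_⟩, fun k => ?_, fun k l hkl => ?_, hv, hspan,
    fun k => by rw [inv_inv, hKv], fun k => (hshift _).symm, fun c u hc hu => ?_⟩
  · have h1 := hKv k
    have h2 : Z (T (v k)) = 0 := h0
    rw [hK, h2, map_zero, map_zero] at h1
    exact smul_ne_zero (hspos k).ne' (hv.ne_zero k) h1.symm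
  · have h1 : v k = T ((s k)⁻¹ • P (Z (T (v k)))) := by
      rw [map_smul, ← hK, hKv, smul_smul, inv_mul_cancel₀ (hspos k).ne', one_smul]
    have h2 := hχ.isWeakNeumannSolution_invSqrt hΩ hb hT
      (f := (s k)⁻¹ • P (Z (T (v k)))) (by rw [inner_smul_right, hzero, mul_zero])
      (⨍ x in D, T (v k) x)
    rw [← h1] at h2
    rw [hP, hZ] at h2
    beta_reduce
    rw [hZ]
    exact h2
  · beta_reduce
    rw [setIntegral_eq_inner hD hDΩ hb, hZ, inner_one_center hD hDΩ hb]
  · rw [← inner_cutoff_left hD hDΩ, ← cutoff_cutoff, inner_cutoff_comm hD hDΩ, ← hP, ← hP,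
      ← hKinner, hKv, real_inner_smul_left, hv.2 hkl, mul_zero]
  · have hmean : inner ℝ (cutoff hD (constL2 hb 1)) u = 0 := by
      obtain ⟨g, -, hg⟩ := isWeakNeumannSolution_iff.1 hu
      have h1 := hg _ _ (isWeakGradient_constL2 hb 1)
      rw [inner_zero_right, real_inner_smul_left, inner_cutoff_comm hD hDΩ] at h1
      rw [real_inner_comm]
      exact (mul_eq_zero.1 h1.symm).resolve_left hc
    have hZu : Z u = u := by rw [hZ, center_eq_self hD hDΩ hb hmean]
    obtain ⟨α, hα⟩ := hχ.eq_of_isWeakNeumannSolution hΩ hb hT hu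
    -- `w` is the candidate eigenvector of `K`: u is `T w` plus a constant, and `Z` removes the
    -- constant.
    set w := T (c • cutoff hD u) with hw
    have hZw : Z (T w) = u := by
      have h1 := congrArg Z hα
      rw [map_add, map_smul, hZ (constL2 hb 1), center_one hD hDΩ hb, smul_zero, add_zero,
        hZu] at h1
      exact h1.symm
    have hwc : w = c • K w := by rw [hK, hZw, hP, hw, map_smul]
    have hwmem : w ∈ (Submodule.span ℝ (Set.range v)).topologicalClosure := by
      rw [hspan, Submodule.mem_orthogonal]
      intro z hz
      have hz0 : K z = 0 := hz
      rw [hwc, inner_smul_right, ← hKsymm, hz0, inner_zero_left, mul_zero]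
    have hfin : {k | (s k)⁻¹ = c}.Finite := by
      obtain ⟨N, hN⟩ := eventually_atTop.1 (hlam.eventually_gt_atTop c)
      refine (Set.finite_Iio N).subset fun k hk => ?_
      by_contra hkN
      exact (hN k (not_lt.1 hkN)).ne' hk
    -- Pairing w = c K w with v_k gives (c s_k − 1)⟨v_k, w⟩ = 0, so only indices with λ_k = c
    -- contribute.
    have hwspan := mem_span_image_of_inner_eq_zero hv hwmem hfin fun k hk => by
      have h1 : inner ℝ (v k) w = c * s k * inner ℝ (v k) w := by
        conv_lhs => rw [hwc]
        rw [inner_smul_right, ← hKsymm, hKv, real_inner_smul_left, mul_assoc]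
      by_contra hne
      have h2 : c * s k = 1 := by
        have : (c * s k - 1) * inner ℝ (v k) w = 0 := by linarith
        linarith [(mul_eq_zero.1 this).resolve_right hne]
      exact hk (eq_inv_of_mul_eq_one_left h2).symm
    have hmap := Submodule.mem_map_of_mem (f := ((Z ∘L T : L2 Ω →L[ℝ] L2 Ω) : L2 Ω →ₗ[ℝ] L2 Ω))
      hwspan
    rw [Submodule.map_span, ← Set.image_comp] at hmap
    rw [← hZw]
    exact hmap

end

end DegenerateNeumann

end

theorem theorem2p4 (d : ℕ) (hd : 2 ≤ d) (Ω D : Set (EuclideanSpace ℝ (Fin d)))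
    (hΩ : DegenerateNeumann.IsLipschitzDomain Ω) (hΩb : Bornology.IsBounded Ω)
    (hD : DegenerateNeumann.IsLipschitzDomain D) (hDΩ : closure D ⊆ Ω) :
    -- the Neumann Laplacian of `Ω` has an orthonormal basis of eigenfunctions
    (∃ (χ : ℕ → DegenerateNeumann.L2 Ω) (μ : ℕ → ℝ),
      DegenerateNeumann.IsNeumannEigenbasis Ω χ μ) ∧
    ∀ (χ : ℕ → DegenerateNeumann.L2 Ω) (μ : ℕ → ℝ),
      DegenerateNeumann.IsNeumannEigenbasis Ω χ μ →
      (μ 0 = 0 ∧ χ 0 ∈ Set.range (DegenerateNeumann.constL2 hΩb) ∧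
        (∀ k, 0 < μ (k + 1)) ∧ Tendsto μ atTop atTop) ∧
      -- `T` is `(-Δ)^{-1/2}`
      ∃ T : DegenerateNeumann.L2 Ω →L[ℝ] DegenerateNeumann.L2 Ω,
        DegenerateNeumann.IsInvSqrtNeumann χ μ T ∧
        -- the operator `(-Δ)^{-1/2} 1_D (-Δ)^{-1/2}`
        (∃ K₀ : DegenerateNeumann.L2 Ω →L[ℝ] DegenerateNeumann.L2 Ω,
          (∀ v, K₀ v = T (DegenerateNeumann.cutoff hD (T v))) ∧
          IsCompactOperator K₀ ∧ IsSelfAdjoint K₀ ∧ ∀ v, 0 ≤ inner ℝ (K₀ v) v) ∧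
        -- the same operator with the constants normalized by zero mean over `D`
        ∃ K : DegenerateNeumann.L2 Ω →L[ℝ] DegenerateNeumann.L2 Ω,
          (∀ v, K v = T (DegenerateNeumann.cutoff hD
            (DegenerateNeumann.shifted D hΩb T v))) ∧
          IsCompactOperator K ∧ IsSelfAdjoint K ∧ (∀ v, 0 ≤ inner ℝ (K v) v) ∧
          ∃ (lam : ℕ → ℝ) (v φ : ℕ → DegenerateNeumann.L2 Ω),
            -- the eigenvalues
            (∀ k, 0 < lam k) ∧ Monotone lam ∧ Tendsto lam atTop atTop ∧
            -- the eigenfunctions of the degenerate Neumann problem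
            (∀ k, φ k ≠ 0 ∧ DegenerateNeumann.IsWeakNeumannSolution Ω (φ k)
              (lam k • DegenerateNeumann.cutoff hD (φ k))) ∧
            (∀ k, ∫ x in D, φ k x = 0) ∧
            (∀ k l, k ≠ l → ∫ x in D, φ k x * φ l x = 0) ∧
            -- they come from an orthonormal eigenbasis of `K`
            Orthonormal ℝ v ∧
            (Submodule.span ℝ (Set.range v)).topologicalClosure =
              (LinearMap.ker (K : DegenerateNeumann.L2 Ω →ₗ[ℝ] DegenerateNeumann.L2 Ω))ᗮ ∧
            (∀ k, K (v k) = (lam k)⁻¹ • v k) ∧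
            (∀ k, φ k = DegenerateNeumann.shifted D hΩb T (v k)) ∧
            -- and they exhaust the problem, with multiplicities
            (∀ (c : ℝ) (u : DegenerateNeumann.L2 Ω), c ≠ 0 →
              DegenerateNeumann.IsWeakNeumannSolution Ω u
                (c • DegenerateNeumann.cutoff hD u) →
              u ∈ Submodule.span ℝ (φ '' {k | lam k = c})) := by
  have hd0 : 0 < d := by omega
  have hsub : D ⊆ Ω := subset_closure.trans hDΩ
  refine ⟨DegenerateNeumann.exists_isNeumannEigenbasis hd0 hΩ hΩb, fun χ μ hχ => ?_⟩
  obtain ⟨T, hT⟩ := hχ.exists_invSqrt hΩ hΩb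
  obtain ⟨a, ha⟩ := hχ.exists_const hΩ hΩb (hχ.eigenvalue_zero hΩ hΩb)
  refine ⟨⟨hχ.eigenvalue_zero hΩ hΩb, ⟨a, ha.symm⟩, hχ.eigenvalue_succ_pos hΩ hΩb,
    hχ.tendsto_atTop hΩ hΩb⟩, T, hT, ?_,
    hχ.exists_degenerate_eigenbasis hd0 hΩ hΩb hD hsub hT⟩
  obtain ⟨P, hP⟩ := DegenerateNeumann.exists_cutoffL (Ω := Ω) hD
  have hTs := DegenerateNeumann.isSymmetric_of_diagonal hT
  -- Multiplication by the indicator is itself an orthogonal projection, so the factorization used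
  -- for `K` holds without centering.
  have hinner : ∀ x y, inner ℝ (T (P (T x))) y = inner ℝ (P (T x)) (P (T y)) := fun x y => by
    rw [hTs, hP, hP, ← DegenerateNeumann.inner_cutoff_comm hD hsub,
      DegenerateNeumann.cutoff_cutoff]
  refine ⟨T ∘L P ∘L T, fun v => by simp [hP], (hχ.isCompactOperator hΩ hΩb hT).comp_clm (P ∘L T),
    ?_, fun v => ?_⟩
  · rw [ContinuousLinearMap.isSelfAdjoint_iff_isSymmetric]
    intro x y
    change inner ℝ (T (P (T x))) y = inner ℝ x (T (P (T y)))
    rw [hinner, real_inner_comm, ← hinner, real_inner_comm]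
  · change 0 ≤ inner ℝ (T (P (T v))) v
    rw [hinner]
    exact real_inner_self_nonneg
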